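/- **Theorem.** Let $\rho$ be a finite relational vocabulary and let $k,\ell,q\in\mathbb N$ with $k\ge 1$ or $\ell=0$. Then there are $q^*,r^*\in\mathbb N$, a learning algorithm $\mathfrak M$ and an evaluation algorithm $\mathfrak E$ (all depending only on $\rho,k,\ell,q$) such that the following holds for every finite $\rho$-structure $B$ with universe $U(B)$ and every training sequence $T=((\bar u_1,c_1),\dots,(\bar u_t,c_t))\in(U(B)^k\times\{0,1\})^t$ with $t\ge 1$. Let $n=|U(B)|$ and let $d$ be the maximum degree of the Gaifman graph of $B$ (two distinct elements are adjacent if they occur together in a tuple of a relation of $B$). For a first-order formula $\phi(\bar x;\bar y)$ with $|\bar x|=k$, $|\bar y|=\ell$ and $\bar v\in U(B)^\ell$, let $[\![\phi(\bar x;\bar v)]\!]^B:U(B)^k\to\{0,1\}$ be the function with value $1$ at $\bar u$ iff $B\models\phi(\bar u;\bar v)$, and let $\mathrm{err}_T(H)=\frac1t|\{i: H(\bar u_i)\ne c_i\}|$. A formula $\psi(\bar z)$ is $r$-local if for all $\rho$-structures $A$ and tuples $\bar w$, $A\models\psi(\bar w)$ iff $N_r^A(\bar w)\models\psi(\bar w)$,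 where $N^A_r(\bar w)$ is the substructure induced on the elements at distance at most $r$ from $\bar w$ in the Gaifman graph of $A$. 1. On input $T$, with only local access to $B$, $\mathfrak M$ always returns a hypothesis $H=[\![\phi^*(\bar x;\bar v^*)]\!]^B$, given by an $r^*$-local first-order formula $\phi^*(\bar x;\bar y)$ of quantifier rank $q^*$ and a tuple $\bar v^*\in U(B)^\ell$. 2. For every real $\epsilon$: if there are a first-order formula $\phi(\bar x;\bar y)$ of quantifier rank at most $q$ and $\bar v\in U(B)^\ell$ with $\mathrm{err}_T([\![\phi(\bar x;\bar v)]\!]^B)\le\epsilon$, then $\mathrm{err}_T(H)\le\epsilon$. 3. $\mathfrak M$ runs in time $(\log n+d+t)^{O(1)}$ with only local access to $B$. 4. The hypotheses returned by $\mathfrak M$ can be evaluated in time $(\log n+d)^{O(1)}$ with only local access to $B$: given $\phi^*,\bar v^*$ and any $\bar u\in U(B)^k$, $\mathfrak E$ computes $H(\bar u)$ within this time. Here the constants hidden in $O(1)$ depend only on $\rho,k,\ell,q$, and $f^{O(1)}$ stands for a bound $c\,(f+1)^c$. Local access means that the algorithm reaches $B$ only through the elements in its input and through the queries "is $(u_1,\dots,u_m)\in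 R(B)$?" (constant time) and "list all neighbours of $u$" (in any order; time proportional to the size of the answer). Time is measured with the logarithmic cost measure, in which storing an element of $B$ takes $\lfloor\log_2 n\rfloor+1$ space. -/

import Mathlib

namespace LocalLearning

/-! ### Structures, Gaifman graphs and first-order logic -/

/-- The Gaifman graph of a structure: two distinct elements are adjacent if they occur together
in a tuple of some relation. -/
def gaifmanGraph (L : FirstOrder.Language.{0, 0}) (U : Type) [L.Structure U] : SimpleGraph U where
  Adj u v := u ≠ v ∧ ∃ (n : ℕ) (R : L.Relations n) (x : Fin n → U),
    FirstOrder.Language.Structure.RelMap R x ∧ u ∈ Set.range x ∧ v ∈ Set.range x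
  symm := ⟨fun _ _ h => by
    obtain ⟨hne, n, R, x, hx, hu, hv⟩ := h
    exact ⟨hne.symm, n, R, x, hx, hv, hu⟩⟩
  loopless := ⟨fun _ h => h.1 rfl⟩

open Classical in
/-- The maximum degree of a finite structure. -/
noncomputable def maxDegree (L : FirstOrder.Language.{0, 0}) (U : Type) [L.Structure U] [Fintype U] : ℕ :=
  (gaifmanGraph L U).maxDegree

/-- The substructure induced on the `r`-neighbourhood of a tuple, that is, on the set of all
elements at distance at most `r` from some entry of the tuple. -/
def nbhd (L : FirstOrder.Language.{0, 0}) [L.IsRelational] {U : Type} [L.Structure U] {α : Type}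
    (r : ℕ) (u : α → U) : L.Substructure U where
  carrier := {v | ∃ a, (gaifmanGraph L U).edist (u a) v ≤ (r : ℕ∞)}
  fun_mem f := isEmptyElim f

theorem mem_nbhd (L : FirstOrder.Language.{0, 0}) [L.IsRelational] {U : Type} [L.Structure U] {α : Type}
    (r : ℕ) (u : α → U) (a : α) : u a ∈ nbhd L r u :=
  ⟨a, by simp⟩

/-- A formula `φ` is `r`-local if for all structures `A` and all tuples `u` of elements,
`A ⊨ φ(u)` if and only if `N_r(u) ⊨ φ(u)`. -/
def IsLocal {L : FirstOrder.Language.{0, 0}} [L.IsRelational] {α : Type} (r : ℕ) (φ : L.Formula α) : Prop :=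
  ∀ (A : Type) [L.Structure A] (u : α → A),
    φ.Realize u ↔ φ.Realize (fun a => (⟨u a, mem_nbhd L r u a⟩ : nbhd L r u))

/-- The quantifier rank: the nesting depth of quantifiers. -/
def qrank {L : FirstOrder.Language.{0, 0}} {α : Type} : {n : ℕ} → L.BoundedFormula α n → ℕ
  | _, .falsum => 0
  | _, .equal _ _ => 0
  | _, .rel _ _ => 0
  | _, .imp φ ψ => max (qrank φ) (qrank ψ)
  | _, .all φ => qrank φ + 1

open Classical in
/-- The concept `⟦φ(x̄ ; v)⟧ : U^k → {0, 1}` defined by `φ(x̄ ; ȳ)` and the parameter tuple `v`. -/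
noncomputable def concept {L : FirstOrder.Language.{0, 0}} {U : Type} [L.Structure U] {k l : ℕ}
    (φ : L.Formula (Fin k ⊕ Fin l)) (v : Fin l → U) : (Fin k → U) → Bool :=
  fun u => decide (φ.Realize (Sum.elim u v))

/-- The training error of `H` on the training sequence `T`: the fraction of examples on which
`H` is wrong. -/
noncomputable def trainErr {X : Type} (T : List (X × Bool)) (H : X → Bool) : ℝ :=
  (T.countP (fun p => H p.1 != p.2) : ℝ) / (T.length : ℝ)

/-! ### Data and their encodings -/

/-- Data manipulated by algorithms over a structure with universe `U`: binary trees whose leaves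
are empty or hold an element of the structure. Elements are opaque, so that an algorithm can only
get hold of elements in its input and of elements returned by neighbourhood queries. -/
inductive Val (U : Type) : Type
  | nil : Val U
  | elem (u : U) : Val U
  | cons (a b : Val U) : Val U

namespace Val

variable {U : Type}

/-- Size of the representation, where storing an element takes space `w`. -/
def size (w : ℕ) : Val U → ℕ
  | nil => 1
  | elem _ => w
  | cons a b => 1 + size w a + size w b

def hd : Val U → Val U
  | cons a _ => a
  | _ => nil

def tl : Val U → Val U
  | cons _ b => b
  | _ => nil

def ofBool : Bool → Val U
  | false => nil
  | true => cons nil nil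

def ofList : List (Val U) → Val U
  | [] => nil
  | a :: l => cons a (ofList l)

/-- Natural numbers in unary. -/
def ofNat : ℕ → Val U
  | 0 => nil
  | n + 1 => cons nil (ofNat n)

/-- A tuple of elements, as a list. -/
def ofTuple {m : ℕ} (u : Fin m → U) : Val U :=
  ofList (List.ofFn fun i => elem (u i))

/-- A training sequence, as a list of pairs (instance, label). -/
def ofTraining {k : ℕ} (T : List ((Fin k → U) × Bool)) : Val U :=
  ofList (T.map fun p => cons (ofTuple p.1) (ofBool p.2))

/-- Variables: instance variable, parameter variable, or bound variable, with its index. -/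
def ofVar {k l n : ℕ} : (Fin k ⊕ Fin l) ⊕ Fin n → Val U
  | .inl (.inl i) => cons (ofNat 0) (ofNat i)
  | .inl (.inr j) => cons (ofNat 1) (ofNat j)
  | .inr i => cons (ofNat 2) (ofNat i)

def ofTerm {L : FirstOrder.Language.{0, 0}} [L.IsRelational] {k l n : ℕ} :
    L.Term ((Fin k ⊕ Fin l) ⊕ Fin n) → Val U
  | .var x => ofVar x
  | .func f _ => isEmptyElim f

/-- Formulas, as their syntax trees. -/
def ofFormula {L : FirstOrder.Language.{0, 0}} [L.IsRelational] [Encodable (Σ n, L.Relations n)]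
    {k l : ℕ} : {n : ℕ} → L.BoundedFormula (Fin k ⊕ Fin l) n → Val U
  | _, .falsum => cons (ofNat 0) nil
  | _, .equal s t => cons (ofNat 1) (cons (ofTerm s) (ofTerm t))
  | _, .rel (l := m) R ts => cons (ofNat 2)
      (cons (ofNat (Encodable.encode (⟨m, R⟩ : Σ n, L.Relations n)))
        (ofList (List.ofFn fun i => ofTerm (ts i))))
  | _, .imp φ ψ => cons (ofNat 3) (cons (ofFormula φ) (ofFormula ψ))
  | _, .all φ => cons (ofNat 4) (ofFormula φ)

end Val

/-! ### Algorithms with local access, and their running time -/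

/-- Expressions; variables of programs are numbered by natural numbers. -/
inductive Expr : Type
  | var (x : ℕ) : Expr
  | nil : Expr
  | cons (e f : Expr) : Expr
  | hd (e : Expr) : Expr
  | tl (e : Expr) : Expr
  | eq (e f : Expr) : Expr

open Classical in
/-- The value of an expression in a state. -/
noncomputable def Expr.eval {U : Type} (s : ℕ → Val U) : Expr → Val U
  | .var x => s x
  | .nil => .nil
  | .cons e f => .cons (e.eval s) (f.eval s)
  | .hd e => (e.eval s).hd
  | .tl e => (e.eval s).tl
  | .eq e f => .ofBool (decide (e.eval s = f.eval s))

/-- The time needed to evaluate an expression: the total size of all the values computed on the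
way (including copies of the variables), where an element has size `w`. -/
noncomputable def Expr.cost {U : Type} (w : ℕ) (s : ℕ → Val U) : Expr → ℕ
  | .var x => (s x).size w
  | .nil => 1
  | .cons e f => ((Expr.cons e f).eval s).size w + e.cost w s + f.cost w s
  | .hd e => ((Expr.hd e).eval s).size w + e.cost w s
  | .tl e => ((Expr.tl e).eval s).size w + e.cost w s
  | .eq e f => ((Expr.eq e f).eval s).size w + e.cost w s + f.cost w s

/-- Programs with local access to a structure of vocabulary `L`. -/
inductive Prog (L : FirstOrder.Language.{0, 0}) : Type
  /-- `x := e` -/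
  | assign (x : ℕ) (e : Expr) : Prog L
  /-- relation query: `y` gets the answer to the question whether the tuple of elements stored in
  the variables `xs` belongs to the relation `R` -/
  | rel {n : ℕ} (y : ℕ) (R : L.Relations n) (xs : Fin n → ℕ) : Prog L
  /-- neighbourhood query: `y` gets the list of all neighbours of the element stored in `x` -/
  | nbrs (y : ℕ) (x : ℕ) : Prog L
  | seq (p q : Prog L) : Prog L
  /-- if `x` is not `nil` then `p` else `q` -/
  | ite (x : ℕ) (p q : Prog L) : Prog L
  /-- while `x` is not `nil` do `p` -/
  | loop (x : ℕ) (p : Prog L) : Prog L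

/-- An oracle for neighbourhood queries: it returns the neighbours of each element, each exactly
once, in an arbitrary order. -/
structure NbrOracle (L : FirstOrder.Language.{0, 0}) (U : Type) [L.Structure U] where
  list : U → List U
  nodup : ∀ u, (list u).Nodup
  mem_list : ∀ u v, v ∈ list u ↔ (gaifmanGraph L U).Adj u v

section Semantics

variable {L : FirstOrder.Language.{0, 0}} {U : Type} [L.Structure U]

open Classical in
/-- The answer to a relation query. -/
noncomputable def relAnswer {n : ℕ} (R : L.Relations n) (xs : Fin n → ℕ) (s : ℕ → Val U) : Val U :=
  .ofBool (decide (∃ u : Fin n → U,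
    (∀ i, s (xs i) = .elem (u i)) ∧ FirstOrder.Language.Structure.RelMap R u))

/-- The answer to a neighbourhood query. -/
def nbrAnswer (O : NbrOracle L U) : Val U → Val U
  | .elem u => .ofList ((O.list u).map .elem)
  | _ => .nil

/-- `Exec O w p s s' t`: started in the state `s`, the program `p` halts in the state `s'` after
`t` time units, if elements have size `w`. A relation query takes constant time, and a
neighbourhood query takes time proportional to the size of its answer. -/
inductive Exec (O : NbrOracle L U) (w : ℕ) :
    Prog L → (ℕ → Val U) → (ℕ → Val U) → ℕ → Prop
  | assign (s : ℕ → Val U) (x : ℕ) (e : Expr) :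
      Exec O w (.assign x e) s (Function.update s x (e.eval s)) (1 + e.cost w s)
  | rel (s : ℕ → Val U) {n : ℕ} (y : ℕ) (R : L.Relations n) (xs : Fin n → ℕ) :
      Exec O w (.rel y R xs) s (Function.update s y (relAnswer R xs s)) 1
  | nbrs (s : ℕ → Val U) (y x : ℕ) :
      Exec O w (.nbrs y x) s (Function.update s y (nbrAnswer O (s x)))
        (1 + (nbrAnswer O (s x)).size w)
  | seq {p q : Prog L} {s s₁ s₂ : ℕ → Val U} {t₁ t₂ : ℕ} :
      Exec O w p s s₁ t₁ → Exec O w q s₁ s₂ t₂ → Exec O w (.seq p q) s s₂ (t₁ + t₂)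
  | ite_true {x : ℕ} {p q : Prog L} {s s₁ : ℕ → Val U} {t : ℕ} :
      s x ≠ .nil → Exec O w p s s₁ t → Exec O w (.ite x p q) s s₁ (1 + t)
  | ite_false {x : ℕ} {p q : Prog L} {s s₁ : ℕ → Val U} {t : ℕ} :
      s x = .nil → Exec O w q s s₁ t → Exec O w (.ite x p q) s s₁ (1 + t)
  | loop_true {x : ℕ} {p : Prog L} {s s₁ s₂ : ℕ → Val U} {t₁ t₂ : ℕ} :
      s x ≠ .nil → Exec O w p s s₁ t₁ → Exec O w (.loop x p) s₁ s₂ t₂ →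
      Exec O w (.loop x p) s s₂ (1 + t₁ + t₂)
  | loop_false {x : ℕ} {p : Prog L} {s : ℕ → Val U} :
      s x = .nil → Exec O w (.loop x p) s s 1

/-- Programs are deterministic: the final state and the running time are determined. -/
theorem Exec.deterministic {O : NbrOracle L U} {w : ℕ} {p : Prog L} {s s₁ s₂ : ℕ → Val U}
    {t₁ t₂ : ℕ} (h₁ : Exec O w p s s₁ t₁) (h₂ : Exec O w p s s₂ t₂) : s₁ = s₂ ∧ t₁ = t₂ := by
  induction h₁ generalizing s₂ t₂ with
  | assign | rel | nbrs => cases h₂; exact ⟨rfl, rfl⟩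
  | seq _ _ ih₁ ih₂ =>
    cases h₂ with
    | seq g₁ g₂ =>
      obtain ⟨rfl, rfl⟩ := ih₁ g₁
      obtain ⟨rfl, rfl⟩ := ih₂ g₂
      exact ⟨rfl, rfl⟩
  | ite_true hx _ ih =>
    cases h₂ with
    | ite_true _ g => obtain ⟨rfl, rfl⟩ := ih g; exact ⟨rfl, rfl⟩
    | ite_false g _ => exact absurd g hx
  | ite_false hx _ ih =>
    cases h₂ with
    | ite_true g _ => exact absurd hx g
    | ite_false _ g => obtain ⟨rfl, rfl⟩ := ih g; exact ⟨rfl, rfl⟩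
  | loop_true hx _ _ ih₁ ih₂ =>
    cases h₂ with
    | loop_true _ g₁ g₂ =>
      obtain ⟨rfl, rfl⟩ := ih₁ g₁
      obtain ⟨rfl, rfl⟩ := ih₂ g₂
      exact ⟨rfl, rfl⟩
    | loop_false g => exact absurd g hx
  | loop_false hx =>
    cases h₂ with
    | loop_true g _ _ => exact absurd hx g
    | loop_false _ => exact ⟨rfl, rfl⟩

/-- With only local access to the finite structure with universe `U`, the program `p`, started on
the input `a` (in variable `0`, all other variables being `nil`), halts with output `b`
(in variable `0`) after at most `τ` time units, under the logarithmic cost measure: an element of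
a structure with `n` elements takes space `⌊log₂ n⌋ + 1`. -/
def ComputesIn [Fintype U] (O : NbrOracle L U) (p : Prog L) (a b : Val U) (τ : ℕ) : Prop :=
  ∃ (s : ℕ → Val U) (t : ℕ),
    Exec O (Nat.log 2 (Fintype.card U) + 1) p
      (Function.update (fun _ => Val.nil) 0 a) s t ∧ s 0 = b ∧ t ≤ τ

end Semantics

end LocalLearning

/-! Within one fixed structure, Gaifman locality takes a simple form. Consider a back-and-forth game
in which every move must pick an element equal or adjacent to one already chosen (`Eqv`). If two
tuples of the same structure agree for sufficiently many rounds, they satisfy the same first-order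
formulas of quantifier rank `q` (`exists_realize_iff_of_eqv`); global sentences play no role, as
both tuples see the same structure. The core is `Eqv.exists_ext`, which answers an unrestricted move
far from the tuple by comparing scattered sets of elements of the same local type.

Now let `w` be the parameters of an arbitrary competitor `ψ`. By pigeonhole some radius leaves a
wide gap between the parameters near the training instances and the others. The far parameters look
alike from every training instance, so on the training set the truth of `ψ` depends only on the
local type of the instance together with the near parameters (`exists_near_parameters`). Finitely
many guarded formulas determine these types, and guarded formulas are local and first-order
definable. Hence one of finitely many Boolean combinations, fixed in advance, agrees with `ψ` on the
training set, with parameters within a constant radius of it (`GFormula.exists_hypotheses`).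

The learner is exhaustive search: all these formulas, all `l`-tuples from the balls around the
training entries, least number of errors. There are polynomially many candidates in the degree and
the number of examples. The running time comes from a class `PolyTime` closed under composition,
branching and list comprehension; a guarded quantifier is a comprehension over a list of neighbours.
-/

namespace LocalLearning

open FirstOrder Language Structure

/-! ### Guarded back-and-forth equivalence. -/

section Locality

variable (L : FirstOrder.Language.{0, 0}) {U : Type} [L.Structure U]

/-- Equal or adjacent in the Gaifman graph. -/
def Close (x y : U) : Prop := y = x ∨ (gaifmanGraph L U).Adj x y

/-- At distance at most `r` in the Gaifman graph. -/
def Near : ℕ → U → U → Prop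
  | 0, x, y => y = x
  | r + 1, x, y => ∃ z, Close L x z ∧ Near r z y

variable {L}

theorem Close.refl (x : U) : Close L x x := Or.inl rfl

theorem Close.symm {x y : U} (h : Close L x y) : Close L y x := by
  rcases h with rfl | h
  · exact Close.refl _
  · exact Or.inr (SimpleGraph.Adj.symm h)

theorem Near.refl (r : ℕ) (x : U) : Near L r x x := by
  induction r with
  | zero => rfl
  | succ r ih => exact ⟨x, Close.refl x, ih⟩

theorem Near.trans {r s : ℕ} {x y z : U} (h : Near L r x y) (h' : Near L s y z) :
    Near L (r + s) x z := by
  induction r generalizing x with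
  | zero => obtain rfl : y = x := h; simpa using h'
  | succ r ih =>
    obtain ⟨a, ha, hb⟩ := h
    rw [Nat.add_right_comm]
    exact ⟨a, ha, ih hb⟩

theorem near_one {x y : U} : Near L 1 x y ↔ Close L x y := by
  constructor
  · rintro ⟨z, hz, rfl⟩
    exact hz
  · intro h
    exact ⟨y, h, rfl⟩

theorem Near.symm {r : ℕ} {x y : U} (h : Near L r x y) : Near L r y x := by
  induction r generalizing x with
  | zero => exact Eq.symm h
  | succ r ih =>
    obtain ⟨a, ha, hb⟩ := h
    exact (ih hb).trans (near_one.2 ha.symm)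

theorem Near.mono {r s : ℕ} (hrs : r ≤ s) {x y : U} (h : Near L r x y) : Near L s x y := by
  obtain ⟨d, rfl⟩ := Nat.exists_eq_add_of_le hrs
  exact h.trans (Near.refl d y)

theorem edist_le_of_near {r : ℕ} {x y : U} (h : Near L r x y) :
    (gaifmanGraph L U).edist x y ≤ (r : ℕ∞) := by
  induction r generalizing x with
  | zero => obtain rfl : y = x := h; simp
  | succ r ih =>
    obtain ⟨z, hz, hb⟩ := h
    have h1 : (gaifmanGraph L U).edist x z ≤ 1 := by
      rcases hz with rfl | hz
      · simp
      · exact (SimpleGraph.edist_eq_one_iff_adj.2 hz).le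
    calc (gaifmanGraph L U).edist x y
        ≤ (gaifmanGraph L U).edist x z + (gaifmanGraph L U).edist z y :=
          SimpleGraph.edist_triangle
      _ ≤ 1 + (r : ℕ∞) := add_le_add h1 (ih hb)
      _ = ((r + 1 : ℕ) : ℕ∞) := by push_cast; rw [add_comm]

/-- The tuple `u` extended by the element `a`. -/
def ext {α V : Type} (u : α → V) (a : V) : Option α → V := fun o => o.elim a u

@[simp] theorem ext_none {α V : Type} (u : α → V) (a : V) : ext u a none = a := rfl
@[simp] theorem ext_some {α V : Type} (u : α → V) (a : V) (i : α) : ext u a (some i) = u i := rfl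

theorem ext_comp_map {α β V : Type} (u : α → V) (a : V) (f : β → α) :
    ext u a ∘ Option.map f = ext (u ∘ f) a := by
  funext o; cases o <;> rfl

variable (L)

/-- Two tuples satisfy the same atomic formulas. -/
def AtomicEqv {α : Type} (u u' : α → U) : Prop :=
  (∀ i j, u i = u j ↔ u' i = u' j) ∧
  ∀ (n : ℕ) (R : L.Relations n) (xs : Fin n → α), RelMap R (u ∘ xs) ↔ RelMap R (u' ∘ xs)

/-- `m`-round back-and-forth equivalence of tuples where each move picks an element adjacent (or
equal) to an element chosen before. -/
def Eqv : ℕ → {α : Type} → (α → U) → (α → U) → Prop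
  | 0, _, u, u' => AtomicEqv L u u'
  | m + 1, _, u, u' => Eqv m u u' ∧ ∀ i,
      (∀ z, Close L (u i) z → ∃ z', Close L (u' i) z' ∧ Eqv m (ext u z) (ext u' z')) ∧
      (∀ z', Close L (u' i) z' → ∃ z, Close L (u i) z ∧ Eqv m (ext u z) (ext u' z'))

variable {L}

theorem Eqv.refl (m : ℕ) {α : Type} (u : α → U) : Eqv L m u u := by
  induction m generalizing α with
  | zero => exact ⟨fun _ _ => Iff.rfl, fun _ _ _ => Iff.rfl⟩
  | succ m ih => exact ⟨ih u, fun i => ⟨fun z hz => ⟨z, hz, ih _⟩, fun z hz => ⟨z, hz, ih _⟩⟩⟩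

theorem Eqv.symm {m : ℕ} {α : Type} {u u' : α → U} (h : Eqv L m u u') : Eqv L m u' u := by
  induction m generalizing α with
  | zero => exact ⟨fun i j => (h.1 i j).symm, fun n R xs => (h.2 n R xs).symm⟩
  | succ m ih =>
    refine ⟨ih h.1, fun i => ⟨fun z hz => ?_, fun z hz => ?_⟩⟩
    · obtain ⟨z', h1, h2⟩ := (h.2 i).2 z hz
      exact ⟨z', h1, ih h2⟩
    · obtain ⟨z', h1, h2⟩ := (h.2 i).1 z hz
      exact ⟨z', h1, ih h2⟩

theorem Eqv.trans {m : ℕ} {α : Type} {u v w : α → U} (h : Eqv L m u v) (h' : Eqv L m v w) :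
    Eqv L m u w := by
  induction m generalizing α with
  | zero => exact ⟨fun i j => (h.1 i j).trans (h'.1 i j),
      fun n R xs => (h.2 n R xs).trans (h'.2 n R xs)⟩
  | succ m ih =>
    refine ⟨ih h.1 h'.1, fun i => ⟨fun z hz => ?_, fun z hz => ?_⟩⟩
    · obtain ⟨z', h1, h2⟩ := (h.2 i).1 z hz
      obtain ⟨z'', h3, h4⟩ := (h'.2 i).1 z' h1
      exact ⟨z'', h3, ih h2 h4⟩
    · obtain ⟨z', h1, h2⟩ := (h'.2 i).2 z hz
      obtain ⟨z'', h3, h4⟩ := (h.2 i).2 z' h1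
      exact ⟨z'', h3, ih h4 h2⟩

theorem Eqv.mono {m n : ℕ} (hmn : m ≤ n) {α : Type} {u u' : α → U} (h : Eqv L n u u') :
    Eqv L m u u' := by
  induction n, hmn using Nat.le_induction with
  | base => exact h
  | succ n _ ih => exact ih h.1

theorem Eqv.atomic {m : ℕ} {α : Type} {u u' : α → U} (h : Eqv L m u u') : AtomicEqv L u u' :=
  Eqv.mono (Nat.zero_le m) h

/-- A move next to entry `i` of the selected tuple is a move next to entry `f i` of the full one. As
`f` is arbitrary, this covers dropping, permuting and repeating entries. -/
theorem Eqv.comp {m : ℕ} {α β : Type} {u u' : α → U} (h : Eqv L m u u') (f : β → α) :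
    Eqv L m (u ∘ f) (u' ∘ f) := by
  induction m generalizing α β with
  | zero => exact ⟨fun i j => h.1 (f i) (f j), fun n R xs => h.2 n R (f ∘ xs)⟩
  | succ m ih =>
    refine ⟨ih h.1 f, fun i => ⟨fun z hz => ?_, fun z hz => ?_⟩⟩
    · obtain ⟨z', h1, h2⟩ := (h.2 (f i)).1 z hz
      refine ⟨z', h1, ?_⟩
      simpa only [ext_comp_map] using ih h2 (Option.map f)
    · obtain ⟨z', h1, h2⟩ := (h.2 (f i)).2 z hz
      refine ⟨z', h1, ?_⟩
      simpa only [ext_comp_map] using ih h2 (Option.map f)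

theorem Eqv.of_comp {m : ℕ} {α β : Type} {u u' : α → U} (f : β → α) (g : α → β)
    (hfg : ∀ a, f (g a) = a) (h : Eqv L m (u ∘ f) (u' ∘ f)) : Eqv L m u u' := by
  have h' := h.comp g
  have e : ∀ w : α → U, (w ∘ f) ∘ g = w := fun w => by funext a; simp [hfg]
  rwa [e, e] at h'

/-- Moves inside the `r`-neighbourhood can be answered by moves inside the `r`-neighbourhood. -/
theorem Eqv.exists_of_near {r m : ℕ} {α : Type} {u u' : α → U} (h : Eqv L (m + r) u u') {i : α}
    {a : U} (ha : Near L r (u i) a) : ∃ a', Near L r (u' i) a' ∧ Eqv L m (ext u a) (ext u' a') := by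
  induction r generalizing α with
  | zero =>
    obtain rfl : a = u i := ha
    refine ⟨u' i, rfl, ?_⟩
    have e : ∀ w : α → U, ext w (w i) = w ∘ fun o : Option α => o.getD i := fun w => by
      funext o; cases o <;> rfl
    rw [e, e]
    exact Eqv.comp h _
  | succ r ih =>
    obtain ⟨z, hz, hza⟩ := ha
    obtain ⟨z', hz', h'⟩ := ((show Eqv L (m + r + 1) u u' from h).2 i).1 z hz
    obtain ⟨a', ha', h''⟩ := ih h' (i := none) hza
    refine ⟨a', ⟨z', hz', ha'⟩, ?_⟩
    -- The intermediate vertex `z` of the path is dropped from the tuple.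
    have := h''.comp (fun o : Option α => o.map some)
    rwa [ext_comp_map, ext_comp_map] at this

/-- Walking to `u j` in `r` guarded moves forces, through the equality atoms, the answer `u' j`. -/
theorem Eqv.near {r m : ℕ} (hr : r ≤ m) {α : Type} {u u' : α → U} (h : Eqv L m u u') {i j : α}
    (ha : Near L r (u i) (u j)) : Near L r (u' i) (u' j) := by
  have h0 : Eqv L (0 + r) u u' := h.mono (by omega)
  obtain ⟨a', ha', h'⟩ := h0.exists_of_near ha
  have := (h'.atomic.1 none (some j)).1 rfl
  simp only [ext_none, ext_some] at this
  rwa [← this]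

theorem Close.of_relMap {n : ℕ} {R : L.Relations n} {x : Fin n → U} (h : RelMap R x) (i j : Fin n) :
    Close L (x i) (x j) := by
  by_cases e : x i = x j
  · exact Or.inl e.symm
  · exact Or.inr ⟨e, n, R, x, h, ⟨i, rfl⟩, ⟨j, rfl⟩⟩

/-- Entries of a tuple in a relation are pairwise equal or adjacent, so without closeness across the
two sides the tuple lies on one side. -/
theorem relMap_elim_iff {α β : Type} {u u' : α → U} {w w' : β → U}
    (hu : AtomicEqv L u u') (hw : AtomicEqv L w w')
    (hf : ∀ i j, ¬ Near L 1 (u i) (w j)) {n : ℕ} (R : L.Relations n)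
    (xs : Fin n → α ⊕ β) (h : RelMap R (Sum.elim u w ∘ xs)) : RelMap R (Sum.elim u' w' ∘ xs) := by
  by_cases hl : ∃ ys : Fin n → α, xs = Sum.inl ∘ ys
  · obtain ⟨ys, rfl⟩ := hl
    exact (hu.2 n R ys).1 h
  by_cases hr : ∃ ys : Fin n → β, xs = Sum.inr ∘ ys
  · obtain ⟨ys, rfl⟩ := hr
    exact (hw.2 n R ys).1 h
  exfalso
  have h1 : ∃ i j, xs i = Sum.inr j := by
    by_contra hc
    push Not at hc
    have : ∀ i, ∃ a, xs i = Sum.inl a := fun i => by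
      cases e : xs i with
      | inl a => exact ⟨a, rfl⟩
      | inr b => exact absurd e (hc i b)
    choose ys hys using this
    exact hl ⟨ys, funext hys⟩
  have h2 : ∃ i j, xs i = Sum.inl j := by
    by_contra hc
    push Not at hc
    have : ∀ i, ∃ a, xs i = Sum.inr a := fun i => by
      cases e : xs i with
      | inr a => exact ⟨a, rfl⟩
      | inl b => exact absurd e (hc i b)
    choose ys hys using this
    exact hr ⟨ys, funext hys⟩
  obtain ⟨i, b, hi⟩ := h1
  obtain ⟨j, a, hj⟩ := h2
  have := Close.of_relMap h j i
  simp only [Function.comp, hi, hj, Sum.elim_inl, Sum.elim_inr] at this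
  exact hf a b (near_one.2 this)

/-- Equivalence of tuples that are far apart can be checked separately. -/
theorem Eqv.sum {m : ℕ} {α β : Type} {u u' : α → U} {w w' : β → U}
    (hu : Eqv L m u u') (hw : Eqv L m w w')
    (hf : ∀ i j, ¬ Near L (2 * m + 1) (u i) (w j))
    (hf' : ∀ i j, ¬ Near L (2 * m + 1) (u' i) (w' j)) :
    Eqv L m (Sum.elim u w) (Sum.elim u' w') := by
  induction m generalizing α β with
  | zero =>
    refine ⟨?_, fun n R xs => ⟨relMap_elim_iff hu hw hf R xs,
      relMap_elim_iff (Eqv.symm (m := 0) hu) (Eqv.symm (m := 0) hw) hf' R xs⟩⟩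
    have ne : ∀ {x : α → U} {y : β → U}, (∀ i j, ¬ Near L (2 * 0 + 1) (x i) (y j)) →
        ∀ i j, x i ≠ y j := fun hn i j e => hn i j (e ▸ Near.refl _ _)
    rintro (i | i) (j | j)
    · exact hu.1 i j
    · exact ⟨fun e => (ne hf _ _ e).elim, fun e => (ne hf' _ _ e).elim⟩
    · exact ⟨fun e => (ne hf _ _ (Eq.symm e)).elim, fun e => (ne hf' _ _ (Eq.symm e)).elim⟩
    · exact hw.1 i j
  | succ m ih =>
    have mono : ∀ {x y : U}, ¬ Near L (2 * (m + 1) + 1) x y → ¬ Near L (2 * m + 1) x y :=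
      fun h h' => h (h'.mono (by omega))
    -- A guarded move brings the two sides closer by at most one, so the margin `2 * m + 1` is still
    -- there for the remaining `m` rounds.
    have stepl : ∀ {x y z : U}, ¬ Near L (2 * (m + 1) + 1) x y → Close L x z →
        ¬ Near L (2 * m + 1) z y := fun h hc h' =>
      h (((near_one.2 hc).trans h').mono (by omega))
    have stepr : ∀ {x y z : U}, ¬ Near L (2 * (m + 1) + 1) x y → Close L y z →
        ¬ Near L (2 * m + 1) x z := fun h hc h' =>
      h ((h'.trans (near_one.2 hc.symm)).mono (by omega))
    have kl : ∀ {i z z'}, Close L (u i) z → Close L (u' i) z' → Eqv L m (ext u z) (ext u' z') →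
        Eqv L m (ext (Sum.elim u w) z) (ext (Sum.elim u' w') z') := by
      intro i z z' hz hz' h
      have := ih h hw.1
        (by rintro (_ | a) j; exacts [stepl (hf i j) hz, mono (hf a j)])
        (by rintro (_ | a) j; exacts [stepl (hf' i j) hz', mono (hf' a j)])
      have h2 := this.comp (fun o : Option (α ⊕ β) => (match o with
        | none => Sum.inl none
        | some (.inl a) => Sum.inl (some a)
        | some (.inr b) => Sum.inr b : Option α ⊕ β))
      convert h2 using 1 <;> (funext o; rcases o with _ | _ | _ <;> rfl)
    have kr : ∀ {i z z'}, Close L (w i) z → Close L (w' i) z' → Eqv L m (ext w z) (ext w' z') →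
        Eqv L m (ext (Sum.elim u w) z) (ext (Sum.elim u' w') z') := by
      intro i z z' hz hz' h
      have := ih hu.1 h
        (by rintro j (_ | a); exacts [stepr (hf j i) hz, mono (hf j a)])
        (by rintro j (_ | a); exacts [stepr (hf' j i) hz', mono (hf' j a)])
      have h2 := this.comp (fun o : Option (α ⊕ β) => (match o with
        | none => Sum.inr none
        | some (.inl a) => Sum.inl a
        | some (.inr b) => Sum.inr (some b) : α ⊕ Option β))
      convert h2 using 1 <;> (funext o; rcases o with _ | _ | _ <;> rfl)
    refine ⟨ih hu.1 hw.1 (fun i j => mono (hf i j)) (fun i j => mono (hf' i j)), ?_⟩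
    rintro (i | i)
    · refine ⟨fun z hz => ?_, fun z' hz' => ?_⟩
      · obtain ⟨z', hz', h⟩ := (hu.2 i).1 z hz
        exact ⟨z', hz', kl hz hz' h⟩
      · obtain ⟨z, hz, h⟩ := (hu.2 i).2 z' hz'
        exact ⟨z, hz, kl hz hz' h⟩
    · refine ⟨fun z hz => ?_, fun z' hz' => ?_⟩
      · obtain ⟨z', hz', h⟩ := (hw.2 i).1 z hz
        exact ⟨z', hz', kr hz hz' h⟩
      · obtain ⟨z, hz, h⟩ := (hw.2 i).2 z' hz'
        exact ⟨z, hz, kr hz hz' h⟩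

/-- The entries of `b` are played one after another. Each is reached from an entry of `u` by `D`
guarded moves, so `e * D` rounds pay for all of them. -/
theorem Eqv.exists_tuple {D K e : ℕ} {α : Type} {u u' : α → U} (h : Eqv L (K + e * D) u u')
    (b : Fin e → U) (hb : ∀ j, ∃ i, Near L D (u i) (b j)) :
    ∃ b' : Fin e → U, (∀ j, ∃ i, Near L D (u' i) (b' j)) ∧
      Eqv L K (Sum.elim u b) (Sum.elim u' b') := by
  induction e generalizing K with
  | zero =>
    refine ⟨Fin.elim0, fun j => j.elim0, ?_⟩
    have := (h.mono (Nat.le_add_right K _)).comp (fun s : α ⊕ Fin 0 => s.elim id Fin.elim0)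
    convert this using 1 <;> (funext o; rcases o with _ | j; rfl; exact j.elim0)
  | succ e ih =>
    obtain ⟨b', hb', h'⟩ := ih (K := K + D) (h.mono (by rw [Nat.succ_mul]; omega))
      (fun j => b j.castSucc) (fun j => hb _)
    obtain ⟨i, hi⟩ := hb (Fin.last e)
    obtain ⟨a', ha', h''⟩ := h'.exists_of_near (i := Sum.inl i) hi
    refine ⟨Fin.snoc b' a', fun j => ?_, ?_⟩
    · refine Fin.lastCases ?_ (fun j => ?_) j
      · exact ⟨i, by simpa using ha'⟩
      · simpa using hb' j
    · have := h''.comp (fun s : α ⊕ Fin (e + 1) => (s.elim (fun a => some (Sum.inl a))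
        (Fin.lastCases none fun j => some (Sum.inr j)) : Option (α ⊕ Fin e)))
      convert this using 1
      · funext o
        rcases o with _ | j
        · rfl
        · refine Fin.lastCases ?_ (fun j => ?_) j <;> simp
      · funext o
        rcases o with _ | j
        · rfl
        · refine Fin.lastCases ?_ (fun j => ?_) j <;> simp

/-! ### Unrestricted moves and invariance of first-order formulas. -/

/-- The number of guarded rounds that suffices to answer one unrestricted move so that `m` guarded
rounds are left, for tuples of length at most `N`. -/
def rounds (m N : ℕ) : ℕ := (N + 1) * (2 * m + 1) + 3 * (2 * m + 1) + 5 * m + 5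

/-- An unrestricted move can be answered inside one structure. -/
theorem Eqv.exists_ext {m N : ℕ} {α : Type} [Fintype α] (hN : Fintype.card α ≤ N) {u u' : α → U}
    (h : Eqv L (rounds m N) u u') (a : U) : ∃ a', Eqv L m (ext u a) (ext u' a') := by
  set D := 2 * m + 1 with hD
  by_cases hnear : ∃ i, Near L D (u i) a
  · obtain ⟨i, hi⟩ := hnear
    have h0 : Eqv L (m + D) u u' := h.mono (by unfold rounds; omega)
    obtain ⟨a', -, ha'⟩ := h0.exists_of_near hi
    exact ⟨a', ha'⟩
  push Not at hnear
  let S := 2 * D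
  let typ : U → Unit → U := fun x _ => x
  -- The quantity to compare between `u` and `u'` is how many pairwise distant elements of the local
  -- type of `a` fit near the tuple.
  let Sc : (α → U) → ℕ → Prop := fun v e => ∃ b : Fin e → U,
    (∀ j, ∃ i, Near L D (v i) (b j)) ∧ (∀ j, Eqv L m (typ a) (typ (b j))) ∧
    ∀ i j, i ≠ j → ¬ Near L S (b i) (b j)
  -- Two elements within `D` of the same entry are within `S = 2 * D` of each other, so scattered
  -- elements sit near distinct entries.
  have bound : ∀ e, Sc u e → e ≤ N := by
    rintro e ⟨b, hb, -, hs⟩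
    choose f hf using hb
    have inj : Function.Injective f := by
      intro i j hij
      by_contra hne
      refine hs i j hne ?_
      have := (hf i).symm.trans (hij ▸ hf j)
      exact this.mono (by omega)
    simpa using (Fintype.card_le_of_injective f inj).trans (by simpa using hN)
  have hmax : ∃ e, e ≤ N ∧ Sc u e ∧ ¬ Sc u (e + 1) := by
    by_contra hc
    push Not at hc
    have all : ∀ e, Sc u e := by
      intro e
      induction e with
      | zero => exact ⟨Fin.elim0, fun j => j.elim0, fun j => j.elim0, fun j => j.elim0⟩
      | succ e ih => exact hc e (bound e ih) ih
    exact absurd (bound _ (all (N + 1))) (by omega)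
  obtain ⟨e, heN, he, hne⟩ := hmax
  -- The question whether the whole structure has one more scattered element of this type than fit
  -- near `u` does not mention the tuple. If it has, one of them far from `u'` is an answer, by
  -- `Eqv.sum`.
  by_cases hbig : ∃ b : Fin (e + 1) → U, (∀ j, Eqv L m (typ a) (typ (b j))) ∧
      ∀ i j, i ≠ j → ¬ Near L S (b i) (b j)
  · obtain ⟨b, hbt, hbs⟩ := hbig
    by_cases hfar : ∃ j, ∀ i, ¬ Near L D (u' i) (b j)
    · obtain ⟨j, hj⟩ := hfar
      refine ⟨b j, ?_⟩
      have := Eqv.sum (h.mono (by unfold rounds; omega)) (hbt j)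
        (fun i _ => hnear i) (fun i _ => hj i)
      have h2 := this.comp (fun o : Option α => o.elim (Sum.inr ()) Sum.inl)
      convert h2 using 1 <;> (funext o; cases o <;> rfl)
    -- If all `e + 1` elements were near `u'`, the game would carry them back near `u`, against the
    -- choice of `e`. The `S` spare rounds keep them scattered.
    · exfalso
      push Not at hfar
      apply hne
      have hle : (m + S) + (e + 1) * D ≤ rounds m N := by
        have : (e + 1) * D ≤ (N + 1) * D := Nat.mul_le_mul_right _ (by omega)
        have h2 : rounds m N = (N + 1) * D + 3 * D + 5 * m + 5 := rfl
        omega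
      obtain ⟨c, hc, hcE⟩ := (h.symm.mono hle).exists_tuple b hfar
      refine ⟨c, hc, fun j => ?_, fun i j hij hn => ?_⟩
      · exact (hbt j).trans ((hcE.mono (Nat.le_add_right m S)).comp (fun _ : Unit => Sum.inr j))
      · exact hbs i j hij (hcE.symm.near (i := Sum.inr i) (j := Sum.inr j)
          (Nat.le_add_left S m) hn)
  · obtain ⟨b, hb, hbt, hbs⟩ := he
    -- Otherwise `a` would enlarge the scattered set near `u` to one excluded by `hbig`. So `a` lies
    -- within `D + S` of `u`, and guarded moves answer it.
    have : ∃ j, Near L S (b j) a := by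
      by_contra hc
      push Not at hc
      refine hbig ⟨Fin.snoc b a, fun j => ?_, fun i j => ?_⟩
      · refine Fin.lastCases ?_ (fun j => ?_) j
        · simpa using Eqv.refl m _
        · simpa using hbt j
      · refine Fin.lastCases ?_ (fun j => ?_) j <;> refine Fin.lastCases ?_ (fun i => ?_) i
        · exact fun hh => absurd rfl hh
        · simpa using hc i
        · simpa using fun _ hh => hc j (Near.symm hh)
        · simpa using hbs i j
    obtain ⟨j, hj⟩ := this
    obtain ⟨i, hi⟩ := hb j
    have h0 : Eqv L (m + (D + S)) u u' := h.mono (by unfold rounds; omega)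
    obtain ⟨a', -, ha'⟩ := h0.exists_of_near (hi.trans hj)
    exact ⟨a', ha'⟩

theorem sum_elim_snoc {α : Type} {n : ℕ} (v : α → U) (xs : Fin n → U) (a : U) :
    Sum.elim v (Fin.snoc xs a : Fin (n + 1) → U) = ext (Sum.elim v xs) a ∘
      (fun s => s.elim (fun i => some (Sum.inl i))
        (Fin.lastCases none fun j => some (Sum.inr j))) := by
  funext o
  rcases o with _ | j
  · rfl
  · refine Fin.lastCases ?_ (fun j => ?_) j <;> simp

theorem realize_iff_of_atomic [L.IsRelational] {α : Type} {n : ℕ} {v v' : α → U} {xs xs' : Fin n → U}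
    (h : AtomicEqv L (Sum.elim v xs) (Sum.elim v' xs')) {m : ℕ} (R : L.Relations m)
    (ts : Fin m → L.Term (α ⊕ Fin n)) :
    (BoundedFormula.rel R ts).Realize v xs ↔ (BoundedFormula.rel R ts).Realize v' xs' := by
  have : ∀ i, ∃ x, ts i = Term.var x := fun i => by
    cases e : ts i with
    | var x => exact ⟨x, rfl⟩
    | func f _ => exact isEmptyElim f
  choose ys hys using this
  have := h.2 m R ys
  simp only [BoundedFormula.Realize, hys, Term.realize_var]
  exact this

/-- Over one structure, the formulas of quantifier rank at most `q` are invariant under the guarded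
back-and-forth equivalence with sufficiently many rounds. -/
theorem exists_realize_iff_of_eqv (L : FirstOrder.Language.{0, 0}) [L.IsRelational] (q N : ℕ) :
    ∃ m : ℕ, ∀ (U : Type) [L.Structure U] (α : Type) [Fintype α] (n : ℕ)
      (ψ : L.BoundedFormula α n), qrank ψ ≤ q → Fintype.card α + n ≤ N →
      ∀ (v v' : α → U) (xs xs' : Fin n → U), Eqv L m (Sum.elim v xs) (Sum.elim v' xs') →
        (ψ.Realize v xs ↔ ψ.Realize v' xs') := by
  have atom : ∀ (U : Type) [L.Structure U] (α : Type) (n : ℕ) (s t : L.Term (α ⊕ Fin n))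
      (v v' : α → U) (xs xs' : Fin n → U), AtomicEqv L (Sum.elim v xs) (Sum.elim v' xs') →
      ((BoundedFormula.equal s t).Realize v xs ↔ (BoundedFormula.equal s t).Realize v' xs') := by
    intro U _ α n s t v v' xs xs' h
    rcases s with i | ⟨f, _⟩
    · rcases t with j | ⟨f, _⟩
      · exact h.1 i j
      · exact isEmptyElim f
    · exact isEmptyElim f
  induction q generalizing N with
  | zero =>
    refine ⟨0, fun U _ α _ n ψ hq hN v v' xs xs' h => ?_⟩
    induction ψ with
    | falsum => exact Iff.rfl
    | equal s t => exact atom _ _ _ _ _ _ _ _ _ h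
    | rel R ts => exact realize_iff_of_atomic h R ts
    | imp φ ψ ih1 ih2 =>
      simp only [qrank, max_le_iff] at hq
      exact imp_congr (ih1 hq.1 hN _ _ h) (ih2 hq.2 hN _ _ h)
    | all φ _ => simp [qrank] at hq
  | succ q ih =>
    -- `N` bounds the number of free variables, which a quantifier raises by one.
    obtain ⟨m, hm⟩ := ih (N + 1)
    refine ⟨rounds m N, fun U _ α _ n ψ hq hN v v' xs xs' h => ?_⟩
    induction ψ with
    | falsum => exact Iff.rfl
    | equal s t => exact atom _ _ _ _ _ _ _ _ _ h.atomic
    | rel R ts => exact realize_iff_of_atomic h.atomic R ts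
    | imp φ ψ ih1 ih2 =>
      simp only [qrank, max_le_iff] at hq
      exact imp_congr (ih1 hq.1 hN _ _ h) (ih2 hq.2 hN _ _ h)
    | @all n φ _ =>
      simp only [qrank, Nat.add_le_add_iff_right] at hq
      have key : ∀ (v v' : α → U) (xs xs' : Fin n → U),
          Eqv L (rounds m N) (Sum.elim v xs) (Sum.elim v' xs') →
          (φ.all.Realize v xs → φ.all.Realize v' xs') := by
        intro v v' xs xs' h hr a'
        obtain ⟨a, ha⟩ := h.symm.exists_ext (by simpa using hN) a'
        refine (hm U α (n + 1) φ hq (by omega) v v' (Fin.snoc xs a) (Fin.snoc xs' a') ?_).1 (hr a)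
        rw [sum_elim_snoc, sum_elim_snoc]
        exact (ha.symm).comp _
      exact ⟨key _ _ _ _ h, key _ _ _ _ h.symm⟩

/-! ### Replacing parameters by nearby ones. -/

/-- Otherwise each of the `l + 1` steps from `i * D` to `(i + 1) * D` would capture an index not
captured at any earlier radius, too many for `l` indices. Allowing any `i' ≤ i` in the conclusion
makes monotonicity of `P` unnecessary. -/
theorem exists_gap {l : ℕ} (D : ℕ) (P : ℕ → Fin l → Prop) :
    ∃ i ≤ l, ∀ j, P ((i + 1) * D) j → (∃ i' ≤ i, P (i' * D) j) := by
  by_contra hc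
  push Not at hc
  choose f hf hf' using hc
  have inj : Function.Injective (fun i : Fin (l + 1) => f i (by omega)) := by
    intro i i' h
    by_contra hne
    rcases lt_or_gt_of_ne (fun e => hne (Fin.ext e) : (i : ℕ) ≠ i') with hlt | hlt
    · exact hf' i' (by omega) (i + 1) (by omega)
        ((show f i (by omega) = f i' (by omega) from h) ▸ hf i (by omega))
    · exact hf' i (by omega) (i' + 1) (by omega)
        ((show f i (by omega) = f i' (by omega) from h) ▸ hf i' (by omega))
  simpa using Fintype.card_le_of_injective _ inj

/-- Parameters far from all instances are irrelevant up to local equivalence. -/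
theorem exists_near_parameters (L : FirstOrder.Language.{0, 0}) [L.IsRelational] (k l q : ℕ) :
    ∃ m R : ℕ, ∀ (U : Type) [L.Structure U] (S : Set (Fin k → U)) (t : Fin l → U),
      (∀ j, ∃ u ∈ S, ∃ i, u i = t j) → ∀ (ψ : L.Formula (Fin k ⊕ Fin l)) (w : Fin l → U), qrank ψ ≤ q →
      ∃ v : Fin l → U, (∀ j, ∃ u ∈ S, ∃ i, Near L R (u i) (v j)) ∧
        ∀ u ∈ S, ∀ u' ∈ S, Eqv L m (Sum.elim u v) (Sum.elim u' v) →
          (ψ.Realize (Sum.elim u w) ↔ ψ.Realize (Sum.elim u' w)) := by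
  classical
  obtain ⟨m, hm⟩ := exists_realize_iff_of_eqv L q (k + l)
  let D := 2 * m + 1
  refine ⟨m, l * D, fun U _ S t ht ψ w hψ => ?_⟩
  obtain ⟨i, hil, hi⟩ := exists_gap (l := l) D
    (fun r j => ∃ u ∈ S, ∃ a, Near L r (u a) (w j))
  let J : Fin l → Prop := fun j => ∃ u ∈ S, ∃ a, Near L (i * D) (u a) (w j)
  have hJ : ∀ j, ¬ J j → ∀ u ∈ S, ∀ a, ¬ Near L ((i + 1) * D) (u a) (w j) := by
    intro j hj u hu a hn
    obtain ⟨i', hi', u', hu', a', hn'⟩ := hi j ⟨u, hu, a, hn⟩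
    exact hj ⟨u', hu', a', hn'.mono (Nat.mul_le_mul_right _ hi')⟩
  -- Parameters beyond the gap are overwritten by the placeholders `t j`, which only keep the tuple
  -- at length `l` and near the instances.
  refine ⟨fun j => if J j then w j else t j, fun j => ?_, fun u hu u' hu' h => ?_⟩
  · by_cases hj : J j
    · obtain ⟨u, hu, a, hn⟩ := hj
      have hj : J j := ⟨u, hu, a, hn⟩
      exact ⟨u, hu, a, by simpa [hj] using hn.mono (Nat.mul_le_mul_right _ hil)⟩
    · obtain ⟨u, hu, a, hua⟩ := ht j
      exact ⟨u, hu, a, by simpa [hj, hua] using Near.refl _ _⟩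
  · have key : Eqv L m (Sum.elim u w) (Sum.elim u' w) := by
      have h1 := h.comp (fun s : Fin k ⊕ {j // J j} => s.map id Subtype.val)
      have e : ∀ x : Fin k → U, Sum.elim x (fun j => if J j then w j else t j) ∘
          (fun s : Fin k ⊕ {j // J j} => s.map id Subtype.val) =
          Sum.elim x (fun j : {j // J j} => w j) := by
        intro x
        funext s
        rcases s with s | ⟨j, hj⟩
        · rfl
        · simp [hj]
      rw [e, e] at h1
      have far : ∀ x ∈ S, ∀ (s : Fin k ⊕ {j // J j}) (j : {j // ¬ J j}),
          ¬ Near L (2 * m + 1) (Sum.elim x (fun j : {j // J j} => w j) s) (w j) := by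
        rintro x hx (a | ⟨j', y, hy, a, hn⟩) ⟨j, hj⟩ hfar
        · refine hJ j hj x hx a (Near.mono ?_ hfar)
          show D ≤ (i + 1) * D
          rw [Nat.add_one_mul]
          exact Nat.le_add_left _ _
        · refine hJ j hj y hy a (Near.mono ?_ (hn.trans hfar))
          show i * D + D ≤ (i + 1) * D
          rw [Nat.add_one_mul]
      -- The far parameters are the same on both sides and more than `2 * m + 1` away from
      -- everything kept, so they can be put back.
      have h2 := Eqv.sum h1 (Eqv.refl m fun j : {j // ¬ J j} => w j) (far u hu) (far u' hu')
      have h3 := h2.comp (fun s : Fin k ⊕ Fin l => (s.elim (fun a => Sum.inl (Sum.inl a))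
        (fun j => if hj : J j then Sum.inl (Sum.inr ⟨j, hj⟩) else Sum.inr ⟨j, hj⟩) :
          (Fin k ⊕ {j // J j}) ⊕ {j // ¬ J j}))
      convert h3 using 1 <;>
      · funext s
        rcases s with s | j
        · rfl
        · by_cases hj : J j <;> simp [hj]
    refine hm U (Fin k ⊕ Fin l) 0 ψ hψ (by simp) _ _ default default ?_
    have := key.comp (fun s : (Fin k ⊕ Fin l) ⊕ Fin 0 => s.elim id Fin.elim0)
    convert this using 1 <;> (funext s; rcases s with s | j; rfl; exact j.elim0)

end Locality

/-! ### Guarded formulas and local types. -/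

/-- Guarded formulas: quantifiers range over the elements equal or adjacent to a given variable. -/
inductive GFormula (L : FirstOrder.Language.{0, 0}) : ℕ → Type
  | falsum {n : ℕ} : GFormula L n
  | rel {n m : ℕ} (R : L.Relations m) (xs : Fin m → Fin n) : GFormula L n
  | equal {n : ℕ} (i j : Fin n) : GFormula L n
  | imp {n : ℕ} (φ ψ : GFormula L n) : GFormula L n
  | ex {n : ℕ} (i : Fin n) (φ : GFormula L (n + 1)) : GFormula L n

namespace GFormula

variable {L : FirstOrder.Language.{0, 0}}

/-- Satisfaction of a guarded formula. -/
def Sat {U : Type} [L.Structure U] : {n : ℕ} → GFormula L n → (Fin n → U) → Prop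
  | _, falsum, _ => False
  | _, rel R xs, u => RelMap R (u ∘ xs)
  | _, equal i j, u => u i = u j
  | _, imp φ ψ, u => φ.Sat u → ψ.Sat u
  | _, ex i φ, u => ∃ z, Close L (u i) z ∧ φ.Sat (Fin.snoc u z : Fin _ → U)

/-- Nesting depth of the guarded quantifiers. -/
def depth : {n : ℕ} → GFormula L n → ℕ
  | _, falsum => 0
  | _, rel _ _ => 0
  | _, equal _ _ => 0
  | _, imp φ ψ => max φ.depth ψ.depth
  | _, ex _ φ => φ.depth + 1

/-- A formula pinning down a whole truth vector: the building block of disjunctive normal forms and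
of the Hintikka formulas in `exists_finite_family`. -/
theorem exists_conj {n : ℕ} {ι : Type} [Finite ι] (ψ : ι → GFormula L n) (b : ι → Bool) :
    ∃ φ : GFormula L n, ∀ (U : Type) [L.Structure U] (u : Fin n → U),
      φ.Sat u ↔ ∀ i, ((ψ i).Sat u ↔ b i = true) := by
  have list : ∀ l : List ι, ∃ φ : GFormula L n, ∀ (U : Type) [L.Structure U] (u : Fin n → U),
      φ.Sat u ↔ ∀ i ∈ l, ((ψ i).Sat u ↔ b i = true) := by
    intro l
    induction l with
    | nil => exact ⟨imp falsum falsum, fun U _ u => by simp [Sat]⟩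
    | cons i l ih =>
      obtain ⟨φ, hφ⟩ := ih
      cases hb : b i with
      | true =>
        refine ⟨imp (imp (ψ i) (imp φ falsum)) falsum, fun U _ u => ?_⟩
        simp only [Sat, List.mem_cons, forall_eq_or_imp, hb, ← hφ U u]
        tauto
      | false =>
        refine ⟨imp (imp (imp (ψ i) falsum) (imp φ falsum)) falsum, fun U _ u => ?_⟩
        simp only [Sat, List.mem_cons, forall_eq_or_imp, hb, Bool.false_eq_true, ← hφ U u]
        tauto
  have := Fintype.ofFinite ι
  obtain ⟨φ, hφ⟩ := list Finset.univ.toList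
  exact ⟨φ, fun U _ u => by simp [hφ]⟩

open Classical in
/-- Boolean combinations of guarded formulas. -/
theorem exists_boolean {n : ℕ} {ι : Type} [Finite ι] (ψ : ι → GFormula L n)
    (g : (ι → Bool) → Bool) : ∃ φ : GFormula L n, ∀ (U : Type) [L.Structure U] (u : Fin n → U),
      φ.Sat u ↔ g (fun i => decide ((ψ i).Sat u)) = true := by
  have := Fintype.ofFinite ι
  have hc := fun b => exists_conj ψ b
  choose χ hχ using hc
  -- `φ` says that no accepted truth vector is realised; its negation is the disjunctive normal form
  -- of `g`.
  obtain ⟨φ, hφ⟩ := exists_conj (ι := {b // g b = true}) (fun b => χ b) (fun _ => false)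
  refine ⟨imp φ falsum, fun U _ u => ?_⟩
  have key : ∀ b, (χ b).Sat u ↔ b = fun i => decide ((ψ i).Sat u) := by
    intro b
    rw [hχ, funext_iff]
    refine forall_congr' fun i => ?_
    cases b i <;> simp
  simp only [Sat, hφ, key]
  constructor
  · intro h
    by_contra hg
    refine h fun b => ?_
    simp only [Bool.false_eq_true, iff_false]
    intro e
    exact hg (e ▸ b.2)
  · intro h h'
    simpa using h' ⟨_, h⟩

theorem snoc_eq_ext {U : Type} {n : ℕ} (u : Fin n → U) (z : U) :
    ext u z = (Fin.snoc u z : Fin (n + 1) → U) ∘ fun o => o.elim (Fin.last n) Fin.castSucc := by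
  funext o
  cases o <;> simp

/-- Finitely many guarded formulas determine the back-and-forth equivalence class of a tuple. -/
theorem exists_finite_family (L : FirstOrder.Language.{0, 0}) [Finite (Σ n, L.Relations n)]
    (m n : ℕ) : ∃ (ι : Type) (_ : Finite ι) (ψ : ι → GFormula L n),
      ∀ (U : Type) [L.Structure U] (u u' : Fin n → U),
        (∀ i, (ψ i).Sat u ↔ (ψ i).Sat u') → Eqv L m u u' := by
  classical
  induction m generalizing n with
  | zero =>
    refine ⟨(Fin n × Fin n) ⊕ (Σ p : (Σ m, L.Relations m), (Fin p.1 → Fin n)), inferInstance,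
      Sum.elim (fun p => equal p.1 p.2) (fun p => rel p.1.2 p.2), fun U _ u u' h => ⟨?_, ?_⟩⟩
    · exact fun i j => h (Sum.inl (i, j))
    · exact fun m R xs => h (Sum.inr ⟨⟨m, R⟩, xs⟩)
  | succ m ih =>
    obtain ⟨ι, _, ψ, hψ⟩ := ih n
    obtain ⟨ι', _, ψ', hψ'⟩ := ih (n + 1)
    choose χ hχ using fun b => exists_conj ψ' b
    -- The new formulas record, for every entry `i`, which truth vectors of the next level are
    -- realised by a move next to `i`.
    refine ⟨ι ⊕ (Fin n × (ι' → Bool)), inferInstance,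
      Sum.elim ψ (fun p => ex p.1 (χ p.2)), fun U _ u u' h => ?_⟩
    have key : ∀ v v' : Fin n → U, (∀ p : Fin n × (ι' → Bool),
        (ex p.1 (χ p.2)).Sat v ↔ (ex p.1 (χ p.2)).Sat v') → ∀ i z, Close L (v i) z →
        ∃ z', Close L (v' i) z' ∧ Eqv L m (ext v z) (ext v' z') := by
      intro v v' hv i z hz
      obtain ⟨z', hz', h'⟩ := (hv (i, fun i' => decide ((ψ' i').Sat (Fin.snoc v z : Fin _ → U)))).1
        ⟨z, hz, (hχ _ U _).2 fun i' => by simp⟩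
      refine ⟨z', hz', ?_⟩
      rw [hχ] at h'
      rw [snoc_eq_ext, snoc_eq_ext]
      exact (hψ' U _ _ fun i' => by simpa using (h' i').symm).comp _
    refine ⟨hψ U u u' fun i => h (Sum.inl i), fun i => ⟨fun z hz => ?_, fun z' hz' => ?_⟩⟩
    · exact key u u' (fun p => h (Sum.inr p)) i z hz
    · obtain ⟨z, hz, h'⟩ := key u' u (fun p => (h (Sum.inr p)).symm) i z' hz'
      exact ⟨z, hz, h'.symm⟩

/-! ### First-order definability -/

theorem exists_exs {α : Type} (a : ℕ) {m : ℕ} (φ : L.BoundedFormula α (m + a)) :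
    ∃ ψ : L.BoundedFormula α m, ∀ (U : Type) [L.Structure U] (v : α → U) (xs : Fin m → U),
      ψ.Realize v xs ↔ ∃ ys : Fin a → U, φ.Realize v (Fin.append xs ys) := by
  induction a with
  | zero =>
    refine ⟨φ, fun U _ v xs => ?_⟩
    have : ∀ ys : Fin 0 → U, Fin.append xs ys = xs := fun ys => by
      rw [show ys = Fin.elim0 from Subsingleton.elim _ _, Fin.append_elim0]; rfl
    simp [this]
  | succ a ih =>
    obtain ⟨ψ, hψ⟩ := ih (BoundedFormula.ex φ)
    refine ⟨ψ, fun U _ v xs => ?_⟩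
    rw [hψ]
    simp only [BoundedFormula.realize_ex]
    constructor
    · rintro ⟨ys, z, h⟩
      refine ⟨Fin.snoc ys z, ?_⟩
      rwa [Fin.append_snoc]
    · rintro ⟨ys, h⟩
      refine ⟨Fin.init ys, ys (Fin.last a), ?_⟩
      rwa [← Fin.append_snoc, Fin.snoc_init_self]

theorem close_iff {U : Type} [L.Structure U] (x z : U) : Close L x z ↔ z = x ∨
    ∃ (p : Σ m, L.Relations m) (i j : Fin p.1) (ys : Fin p.1 → U),
      RelMap p.2 ys ∧ ys i = x ∧ ys j = z := by
  constructor
  · rintro (h | ⟨-, n, R, y, h, ⟨i, hi⟩, ⟨j, hj⟩⟩)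
    · exact Or.inl h
    · exact Or.inr ⟨⟨n, R⟩, i, j, y, h, hi, hj⟩
  · rintro (h | ⟨p, i, j, ys, h, rfl, rfl⟩)
    · exact Or.inl h
    · exact Close.of_relMap h i j

/-- By `close_iff`, adjacency is a disjunction over relation symbols and pairs of positions, finite
because the vocabulary is. -/
theorem exists_close_formula [Finite (Σ n, L.Relations n)] {α : Type} {m : ℕ} (x y : α ⊕ Fin m) :
    ∃ ψ : L.BoundedFormula α m, ∀ (U : Type) [L.Structure U] (v : α → U) (xs : Fin m → U),
      ψ.Realize v xs ↔ Close L (Sum.elim v xs x) (Sum.elim v xs y) := by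
  have atom : ∀ (p : Σ m, L.Relations m) (i j : Fin p.1), ∃ ψ : L.BoundedFormula α m,
      ∀ (U : Type) [L.Structure U] (v : α → U) (xs : Fin m → U), ψ.Realize v xs ↔
        ∃ ys : Fin p.1 → U, RelMap p.2 ys ∧ ys i = Sum.elim v xs x ∧ ys j = Sum.elim v xs y := by
    intro p i j
    let lift : α ⊕ Fin m → L.Term (α ⊕ Fin (m + p.1)) := fun s =>
      Term.var (s.map id (Fin.castAdd p.1))
    let new : Fin p.1 → L.Term (α ⊕ Fin (m + p.1)) := fun i => Term.var (Sum.inr (Fin.natAdd m i))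
    obtain ⟨ψ, hψ⟩ := exists_exs p.1 (BoundedFormula.rel p.2 new ⊓
      (BoundedFormula.equal (new i) (lift x) ⊓ BoundedFormula.equal (new j) (lift y)))
    refine ⟨ψ, fun U _ v xs => ?_⟩
    have hl : ∀ (s : α ⊕ Fin m) (ys : Fin p.1 → U),
        Term.realize (Sum.elim v (Fin.append xs ys)) (lift s) = Sum.elim v xs s := by
      rintro (s | s) ys <;> simp [lift]
    have hn : ∀ (i : Fin p.1) (ys : Fin p.1 → U),
        Term.realize (Sum.elim v (Fin.append xs ys)) (new i) = ys i := by
      intro i ys; simp [new]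
    rw [hψ]
    refine exists_congr fun ys => ?_
    simp only [BoundedFormula.realize_inf, BoundedFormula.Realize, hl, hn]
  choose ψ hψ using atom
  refine ⟨BoundedFormula.equal (Term.var y) (Term.var x) ⊔
    BoundedFormula.iSup fun q : (Σ p : (Σ m, L.Relations m), Fin p.1 × Fin p.1) =>
      ψ q.1 q.2.1 q.2.2, fun U _ v xs => ?_⟩
  rw [close_iff, BoundedFormula.realize_sup, BoundedFormula.realize_iSup]
  simp only [hψ, Sigma.exists, Prod.exists]
  rfl

/-- Guarded formulas are first-order definable. -/
theorem exists_boundedFormula [Finite (Σ n, L.Relations n)] {n : ℕ} (χ : GFormula L n) {α : Type}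
    {m : ℕ} (ρ : Fin n → α ⊕ Fin m) : ∃ ψ : L.BoundedFormula α m,
      ∀ (U : Type) [L.Structure U] (v : α → U) (xs : Fin m → U),
        ψ.Realize v xs ↔ χ.Sat (Sum.elim v xs ∘ ρ) := by
  induction χ generalizing m with
  | falsum => exact ⟨⊥, fun U _ v xs => Iff.rfl⟩
  | rel R xs => exact ⟨BoundedFormula.rel R (fun i => Term.var (ρ (xs i))), fun U _ v xs => Iff.rfl⟩
  | equal i j => exact ⟨BoundedFormula.equal (Term.var (ρ i)) (Term.var (ρ j)),
      fun U _ v xs => Iff.rfl⟩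
  | imp φ ψ ih1 ih2 =>
    obtain ⟨φ', h1⟩ := ih1 ρ
    obtain ⟨ψ', h2⟩ := ih2 ρ
    exact ⟨φ'.imp ψ', fun U _ v xs => imp_congr (h1 U v xs) (h2 U v xs)⟩
  | @ex n i φ ih =>
    let up : α ⊕ Fin m → α ⊕ Fin (m + 1) := Sum.map id Fin.castSucc
    obtain ⟨φ', h1⟩ := ih (m := m + 1)
      (Fin.snoc (fun i => up (ρ i)) (Sum.inr (Fin.last m)) : Fin (n + 1) → _)
    obtain ⟨γ, h2⟩ := exists_close_formula (L := L) (up (ρ i)) (Sum.inr (Fin.last m))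
    refine ⟨BoundedFormula.ex (γ ⊓ φ'), fun U _ v xs => ?_⟩
    simp only [BoundedFormula.realize_ex, BoundedFormula.realize_inf, h1, h2, Sat]
    refine exists_congr fun z => ?_
    have hup : ∀ s, Sum.elim v (Fin.snoc xs z : Fin (m + 1) → U) (up s) = Sum.elim v xs s := by
      rintro (s | s) <;> simp [up]
    have e : Sum.elim v (Fin.snoc xs z : Fin (m + 1) → U) ∘
        (Fin.snoc (fun i => up (ρ i)) (Sum.inr (Fin.last m)) : Fin (n + 1) → _) =
        (Fin.snoc (Sum.elim v xs ∘ ρ) z : Fin (n + 1) → U) := by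
      funext j
      refine Fin.lastCases ?_ (fun j => ?_) j
      · simp
      · simp [hup]
    rw [e, hup]
    simp

/-! ### Locality -/

/-- All entries of a tuple witnessing adjacency to `x` are themselves equal or adjacent to `x`, so
the tuple survives in `S`. -/
theorem close_coe_iff {U : Type} [L.Structure U] [L.IsRelational] {S : L.Substructure U} {x : S}
    (hx : ∀ y, Close L (x : U) y → y ∈ S) (z : S) : Close L x z ↔ Close L (x : U) z := by
  rw [close_iff, close_iff]
  refine or_congr Subtype.ext_iff (exists_congr fun p => exists_congr fun i => exists_congr fun j =>
    ⟨?_, ?_⟩)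
  · rintro ⟨ys, h, rfl, rfl⟩
    exact ⟨fun i => ys i, h, rfl, rfl⟩
  · rintro ⟨ys, h, h1, h2⟩
    refine ⟨fun a => ⟨ys a, hx _ (h1 ▸ Close.of_relMap h i a)⟩, h, Subtype.ext h1, Subtype.ext h2⟩

/-- Each guarded quantifier moves at most one step away, so a ball of radius `χ.depth + 1` contains
all elements tried and all tuples witnessing their adjacency. -/
theorem sat_coe_iff {U : Type} [L.Structure U] [L.IsRelational] {S : L.Substructure U} {n : ℕ}
    (χ : GFormula L n) (u : Fin n → S)
    (hu : ∀ i y, Near L (χ.depth + 1) (u i : U) y → y ∈ S) :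
    χ.Sat u ↔ χ.Sat fun i => (u i : U) := by
  induction χ with
  | falsum => exact Iff.rfl
  | rel R xs => exact Iff.rfl
  | equal i j => exact Subtype.ext_iff
  | imp φ ψ ih1 ih2 =>
    exact imp_congr
      (ih1 u fun i y h => hu i y (h.mono (Nat.succ_le_succ (le_max_left _ _))))
      (ih2 u fun i y h => hu i y (h.mono (Nat.succ_le_succ (le_max_right _ _))))
  | @ex n i φ ih =>
    have hc : ∀ i y, Close L (u i : U) y → y ∈ S := fun i y h =>
      hu i y ((near_one.2 h).mono (by omega))
    have hz : ∀ z : S, Close L (u i : U) z →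
        (φ.Sat (Fin.snoc u z : Fin _ → S) ↔ φ.Sat (Fin.snoc (fun i => (u i : U)) z : Fin _ → U)) := by
      intro z h
      rw [ih]
      · refine iff_of_eq (congrArg _ (funext fun j => ?_))
        refine Fin.lastCases ?_ (fun j => ?_) j <;> simp
      · intro j
        refine Fin.lastCases ?_ (fun j => ?_) j
        · intro y hy
          exact hu i y ⟨z, h, by simpa [depth] using hy⟩
        · intro y hy
          exact hu j y (Near.mono (r := φ.depth + 1) (Nat.le_succ _) (by simpa using hy))
    constructor
    · rintro ⟨z, h1, h2⟩
      have h1' := (close_coe_iff (hc i) z).1 h1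
      exact ⟨z, h1', (hz z h1').1 h2⟩
    · rintro ⟨z, h1, h2⟩
      exact ⟨⟨z, hc i z h1⟩, (close_coe_iff (hc i) _).2 h1, (hz ⟨z, hc i z h1⟩ h1).2 h2⟩

theorem isLocal_of_sat_iff [L.IsRelational] {α : Type} {n : ℕ} (χ : GFormula L n) (ρ : Fin n → α)
    {φ : L.Formula α} (h : ∀ (U : Type) [L.Structure U] (u : α → U), φ.Realize u ↔ χ.Sat (u ∘ ρ))
    {r : ℕ} (hr : χ.depth + 1 ≤ r) : IsLocal r φ := by
  intro A _ u
  have key := sat_coe_iff (S := nbhd L r u) χ (fun i => ⟨u (ρ i), mem_nbhd L r u (ρ i)⟩)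
    fun i y hy => ⟨ρ i, (edist_le_of_near hy).trans (by exact_mod_cast hr)⟩
  exact (h A u).trans (key.symm.trans (h (nbhd L r u) fun a => ⟨u a, mem_nbhd L r u a⟩).symm)

/-! ### Quantifier rank -/

/-- The rank is raised by the vacuous premise `⊥ → ψ` with `ψ` of rank `q`, so that all hypotheses
get exactly the same rank. -/
theorem exists_qrank_eq {α : Type} (φ : L.Formula α) {q : ℕ} (hq : qrank φ ≤ q) :
    ∃ φ' : L.Formula α, qrank φ' = q ∧
      ∀ (U : Type) [L.Structure U] (u : α → U), φ'.Realize u ↔ φ.Realize u := by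
  have pad : ∀ q n, ∃ ψ : L.BoundedFormula α n, qrank ψ = q := by
    intro q
    induction q with
    | zero => exact fun n => ⟨⊥, rfl⟩
    | succ q ih =>
      intro n
      obtain ⟨ψ, hψ⟩ := ih (n + 1)
      exact ⟨ψ.all, by simp [qrank, hψ]⟩
  obtain ⟨ψ, hψ⟩ := pad q 0
  refine ⟨(BoundedFormula.falsum.imp ψ).imp φ, by simp [qrank, hψ, hq], fun U _ u => ?_⟩
  simp [Formula.Realize, BoundedFormula.Realize]

/-! ### A finite stock of hypotheses. -/

/-- A finite family of pairs of equivalent guarded and first-order formulas, all of the same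
quantifier rank and locality radius, among which optimal hypotheses can be found. -/
theorem exists_hypotheses (L : FirstOrder.Language.{0, 0}) [L.IsRelational]
    [Finite (Σ n, L.Relations n)] (k l q : ℕ) :
    ∃ (qs rs R K : ℕ) (χ : Fin K → GFormula L (k + l)) (φ : Fin K → L.Formula (Fin k ⊕ Fin l)),
      (∀ i, IsLocal rs (φ i) ∧ qrank (φ i) = qs ∧ ∀ (U : Type) [L.Structure U]
        (u : Fin k ⊕ Fin l → U), (φ i).Realize u ↔ (χ i).Sat (u ∘ finSumFinEquiv.symm)) ∧
      ∀ (U : Type) [L.Structure U] (S : Set (Fin k → U)) (t : Fin l → U),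
        (∀ j, ∃ u ∈ S, ∃ a, u a = t j) →
        ∀ (ψ : L.Formula (Fin k ⊕ Fin l)) (w : Fin l → U), qrank ψ ≤ q →
        ∃ (i : Fin K) (v : Fin l → U), (∀ j, ∃ u ∈ S, ∃ a, Near L R (u a) (v j)) ∧
          ∀ u ∈ S, (φ i).Realize (Sum.elim u v) ↔ ψ.Realize (Sum.elim u w) := by
  classical
  obtain ⟨m, R, hR⟩ := exists_near_parameters L k l q
  obtain ⟨ι, _, ψ, hψ⟩ := exists_finite_family L m (k + l)
  have := Fintype.ofFinite ι
  choose χ hχ using fun g => exists_boolean ψ g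
  choose φ hφ using fun g => exists_boundedFormula (χ g) (α := Fin k ⊕ Fin l) (m := 0)
    (fun a => Sum.inl (finSumFinEquiv.symm a))
  let e := Fintype.equivFin ((ι → Bool) → Bool)
  let qs := Finset.univ.sup fun g => qrank (φ g)
  let rs := Finset.univ.sup fun g => (χ g).depth + 1
  have hq : ∀ g, qrank (φ g) ≤ qs := fun g =>
    Finset.le_sup (f := fun g => qrank (φ g)) (Finset.mem_univ g)
  have hr : ∀ g, (χ g).depth + 1 ≤ rs := fun g =>
    Finset.le_sup (f := fun g => (χ g).depth + 1) (Finset.mem_univ g)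
  choose φ' hφ' hφr using fun g => exists_qrank_eq (φ g) (hq g)
  have key : ∀ g (U : Type) [L.Structure U] (u : Fin k ⊕ Fin l → U),
      (φ' g).Realize u ↔ (χ g).Sat (u ∘ finSumFinEquiv.symm) := by
    intro g U _ u
    rw [hφr, Formula.Realize, hφ]
    rfl
  refine ⟨qs, rs, R, _, fun i => χ (e.symm i), fun i => φ' (e.symm i), fun i => ⟨?_, hφ' _, key _⟩,
    ?_⟩
  · exact isLocal_of_sat_iff _ _ (key _) (hr _)
  · intro U _ S t ht ψ₀ w hq₀
    obtain ⟨v, hv, hloc⟩ := hR U S t ht ψ₀ w hq₀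
    let typ : (Fin k → U) → ι → Bool := fun u i =>
      decide ((ψ i).Sat (Sum.elim u v ∘ finSumFinEquiv.symm))
    -- `g` accepts the truth vectors of the instances in `S` that satisfy `ψ₀`; by `hloc` it accepts
    -- no other instance of `S`. It depends on `S`, but is one of the finitely many functions listed
    -- beforehand.
    let g : (ι → Bool) → Bool := fun b => decide (∃ u ∈ S, typ u = b ∧ ψ₀.Realize (Sum.elim u w))
    refine ⟨e g, v, hv, fun u hu => ?_⟩
    rw [key, e.symm_apply_apply, hχ]
    change g (typ u) = true ↔ _
    simp only [g, decide_eq_true_iff]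
    constructor
    · rintro ⟨u', hu', htyp, hr'⟩
      refine (hloc u' hu' u hu ?_).1 hr'
      refine Eqv.of_comp _ finSumFinEquiv (fun a => finSumFinEquiv.symm_apply_apply a)
        (hψ U _ _ fun i => ?_)
      simpa [typ] using congrFun htyp i
    · intro h
      exact ⟨u, hu, rfl, h⟩

end GFormula

/-! ### Lists of values -/

namespace Val

variable {U : Type}

/-- The list that a loop over a value runs through. -/
def toList : Val U → List (Val U)
  | nil => []
  | elem _ => [nil]
  | cons a b => a :: toList b

/-- This includes a bare element, on which a loop runs once with `hd` and `tl` equal to `nil`; hence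
its one-entry list. -/
theorem toList_of_ne_nil {v : Val U} (h : v ≠ nil) : v.toList = v.hd :: v.tl.toList := by
  cases v with
  | nil => exact absurd rfl h
  | elem u => rfl
  | cons a b => rfl

@[simp] theorem toList_ofList (l : List (Val U)) : (ofList l).toList = l := by
  induction l with
  | nil => rfl
  | cons a l ih => simp [ofList, toList, ih]

theorem size_hd_le {w : ℕ} (hw : 1 ≤ w) (v : Val U) : v.hd.size w ≤ v.size w := by
  cases v <;> simp [size, hd] <;> omega

theorem size_tl_le {w : ℕ} (hw : 1 ≤ w) (v : Val U) : v.tl.size w ≤ v.size w := by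
  cases v <;> simp [size, tl]; omega

theorem size_ofBool_le (w : ℕ) (b : Bool) : (ofBool b : Val U).size w ≤ 3 := by
  cases b <;> simp [size, ofBool]

theorem length_toList_le {w : ℕ} (hw : 1 ≤ w) (v : Val U) : v.toList.length ≤ v.size w := by
  induction v with
  | nil => simp [toList]
  | elem u => simpa [toList, size] using hw
  | cons a b _ ih => simp [toList, size]; omega

theorem size_le_of_mem_toList {w : ℕ} (hw : 1 ≤ w) {v a : Val U} (h : a ∈ v.toList) :
    a.size w ≤ v.size w := by
  induction v with
  | nil => simp [toList] at h
  | elem u =>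
    obtain rfl : a = nil := by simpa [toList] using h
    simpa [size] using hw
  | cons b c _ ih =>
    rcases List.mem_cons.1 h with rfl | h
    · simp [size]; omega
    · have := ih h
      simp [size]; omega

theorem size_ofList_le {w G n : ℕ} {l : List (Val U)} (h : ∀ a ∈ l, a.size w ≤ G)
    (hl : l.length ≤ n) : (ofList l).size w ≤ 1 + n * (1 + G) := by
  refine le_trans ?_ (Nat.add_le_add_left (Nat.mul_le_mul_right (1 + G) hl) 1)
  clear hl
  induction l with
  | nil => simp [ofList, size]
  | cons a l ih =>
    have h1 := ih fun b hb => h b (List.mem_cons_of_mem _ hb)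
    have h2 := h a List.mem_cons_self
    simp only [ofList, size, List.length_cons, Nat.succ_mul]
    omega

end Val

/-! ### Loops -/

section Loops

variable {L : FirstOrder.Language.{0, 0}} {U : Type} [L.Structure U]

/-- Termination comes from the list in the tested register getting shorter in every pass. -/
theorem exec_loop (O : NbrOracle L U) (w : ℕ) {x : ℕ} {p : Prog L} {C : ℕ}
    (I : (ℕ → Val U) → Prop)
    (h : ∀ s, I s → s x ≠ .nil → ∃ s' t, Exec O w p s s' t ∧ I s' ∧
      (s' x).toList.length + 1 ≤ (s x).toList.length ∧ t ≤ C) (s : ℕ → Val U) (hs : I s) :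
    ∃ s' t, Exec O w (.loop x p) s s' t ∧ I s' ∧ s' x = .nil ∧
      t ≤ (s x).toList.length * (C + 1) + 1 := by
  induction hn : (s x).toList.length using Nat.strong_induction_on generalizing s with
  | _ n ih =>
    by_cases hx : s x = .nil
    · exact ⟨s, 1, Exec.loop_false hx, hs, hx, by omega⟩
    · obtain ⟨s₁, t₁, e₁, h₁, hlt, ht₁⟩ := h s hs hx
      obtain ⟨s₂, t₂, e₂, h₂, hx₂, ht₂⟩ := ih _ (by omega) s₁ h₁ rfl
      refine ⟨s₂, _, Exec.loop_true hx e₁ e₂, h₂, hx₂, ?_⟩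
      have : (s₁ x).toList.length * (C + 1) + (C + 1) ≤ n * (C + 1) := by
        rw [← Nat.succ_mul]
        exact Nat.mul_le_mul_right _ (by omega)
      omega

/-- Moves the elements of the list in register `x` one by one to the list in register `y`. -/
def revAppendProg (L : FirstOrder.Language.{0, 0}) (x y : ℕ) : Prog L :=
  .loop x (.seq (.assign y (.cons (.hd (.var x)) (.var y))) (.assign x (.tl (.var x))))

/-- Copying the accumulator costs its size, so `B` has to bound every intermediate accumulator. -/
theorem exec_revAppend (O : NbrOracle L U) {w : ℕ} (hw : 1 ≤ w) {x y : ℕ} (hxy : x ≠ y)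
    (s : ℕ → Val U) (A : List (Val U)) (hA : s y = .ofList A) {B G : ℕ}
    (hB : ∀ l₁ l₂, (s x).toList = l₁ ++ l₂ → (Val.ofList (l₁.reverse ++ A)).size w ≤ B)
    (hG : (s x).size w ≤ G) :
    ∃ s' t, Exec O w (revAppendProg L x y) s s' t ∧ s' y = .ofList ((s x).toList.reverse ++ A) ∧
      (∀ i, i ≠ x → i ≠ y → s' i = s i) ∧ t ≤ G * (2 * B + 4 * G + 3) + 1 := by
  let I : (ℕ → Val U) → Prop := fun s' => (∀ i, i ≠ x → i ≠ y → s' i = s i) ∧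
    (s' x).size w ≤ G ∧
    ∃ l, (s x).toList = l ++ (s' x).toList ∧ s' y = .ofList (l.reverse ++ A)
  obtain ⟨s', t, e, ⟨h1, h2, l, hl, hy⟩, hx, ht⟩ := exec_loop O w (x := x) (C := 2 * B + 4 * G + 2)
    (p := .seq (.assign y (.cons (.hd (.var x)) (.var y))) (.assign x (.tl (.var x)))) I
    (by
      rintro s₁ ⟨h1, h2, l, hl, hy⟩ hne
      rw [Val.toList_of_ne_nil hne] at hl
      refine ⟨_, _, Exec.seq (Exec.assign _ _ _) (Exec.assign _ _ _), ⟨?_, ?_, ?_⟩, ?_, ?_⟩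
      · intro i hi hi'
        simp [hi, hi', h1]
      · simpa [Expr.eval, hxy] using (Val.size_tl_le hw (s₁ x)).trans h2
      · exact ⟨l ++ [(s₁ x).hd], by simp [Expr.eval, hxy, hl],
          by simp [Expr.eval, hxy.symm, hy, Val.ofList]⟩
      · simp [Expr.eval, hxy, Val.toList_of_ne_nil hne]
      · have b1 := hB l _ hl
        rw [← hy] at b1
        have b2 := hB (l ++ [(s₁ x).hd]) (s₁ x).tl.toList (by simp [hl])
        have b3 : (Val.cons (s₁ x).hd (s₁ y)).size w ≤ B := by
          simpa [hy, Val.ofList] using b2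
        have b4 := Val.size_hd_le hw (s₁ x)
        have b5 := Val.size_tl_le hw (s₁ x)
        simp only [Expr.cost, Expr.eval, Function.update_of_ne hxy]
        omega)
    s ⟨fun _ _ _ => rfl, hG, [], rfl, hA⟩
  refine ⟨s', t, e, ?_, h1, ?_⟩
  · rw [hx] at hl
    simp only [Val.toList, List.append_nil] at hl
    rw [hy, hl]
  · refine ht.trans (Nat.add_le_add_right (Nat.mul_le_mul_right _ ?_) 1)
    exact (Val.length_toList_le hw _).trans hG

end Loops

/-! ### Polynomial-time functions -/

/-- Families of functions on the values over the structures of vocabulary `L`. -/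
abbrev Family (L : FirstOrder.Language.{0, 0}) (α : Type) : Type 1 :=
  ∀ (U : Type) [L.Structure U], NbrOracle L U → (α → Val U) → Val U

/-- The number `X` bounds the size of an element and the length of the answers of the oracle. -/
structure Bounded {L : FirstOrder.Language.{0, 0}} {U : Type} [L.Structure U] (O : NbrOracle L U)
    (w X : ℕ) : Prop where
  one_le : 1 ≤ w
  le : w ≤ X
  length_le : ∀ u, (O.list u).length ≤ X

theorem Bounded.mono {L : FirstOrder.Language.{0, 0}} {U : Type} [L.Structure U]
    {O : NbrOracle L U} {w X Y : ℕ} (h : Bounded O w X) (hXY : X ≤ Y) : Bounded O w Y :=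
  ⟨h.one_le, h.le.trans hXY, fun u => (h.length_le u).trans hXY⟩

/-- Computability in polynomial time with local access: for every assignment of registers below `N`
to the arguments there is a program that computes the value into register `N`, leaving the
registers below `N` unchanged. -/
def PolyTime {L : FirstOrder.Language.{0, 0}} {α : Type} (f : Family L α) : Prop :=
  ∀ (ρ : α → ℕ) (N : ℕ), (∀ a, ρ a < N) → ∃ (p : Prog L) (τ : Polynomial ℕ),
    ∀ (U : Type) [L.Structure U] (O : NbrOracle L U) (w X : ℕ), Bounded O w X →
      ∀ s : ℕ → Val U, (∀ a, (s (ρ a)).size w ≤ X) →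
        ∃ s' t, Exec O w p s s' t ∧ s' N = f U O (fun a => s (ρ a)) ∧ (∀ i < N, s' i = s i) ∧
          t ≤ τ.eval X ∧ (f U O (fun a => s (ρ a))).size w ≤ τ.eval X

namespace PolyTime

variable {L : FirstOrder.Language.{0, 0}} {α β : Type} {f g h : Family L α}

theorem comp_map (hf : PolyTime f) (e : α → β) :
    PolyTime (L := L) fun U _ O σ => f U O fun a => σ (e a) := by
  intro ρ N hρ
  obtain ⟨p, τ, hp⟩ := hf (fun a => ρ (e a)) N fun a => hρ (e a)
  exact ⟨p, τ, fun U _ O w X hX s hs => hp U O w X hX s fun a => hs (e a)⟩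

theorem var (a : α) : PolyTime (L := L) fun _ _ _ σ => σ a := by
  intro ρ N hρ
  refine ⟨.assign N (.var (ρ a)), Polynomial.X + 1, fun U _ O w X hX s hs => ?_⟩
  refine ⟨_, _, Exec.assign _ _ _, by simp [Expr.eval], fun i hi => by simp [hi.ne], ?_, ?_⟩
  all_goals
    have := hs a
    simp [Expr.cost]
    omega

theorem nil : PolyTime (L := L) (α := α) fun _ _ _ _ => .nil := by
  intro ρ N hρ
  refine ⟨.assign N .nil, 2, fun U _ O w X hX s hs => ?_⟩
  exact ⟨_, _, Exec.assign _ _ _, by simp [Expr.eval], fun i hi => by simp [hi.ne],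
    by simp [Expr.cost], by simp [Val.size]⟩

theorem hd (hf : PolyTime f) : PolyTime (L := L) fun U _ O σ => (f U O σ).hd := by
  intro ρ N hρ
  obtain ⟨p, τ, hp⟩ := hf ρ N hρ
  refine ⟨.seq p (.assign N (.hd (.var N))), 3 * τ + 1, fun U _ O w X hX s hs => ?_⟩
  obtain ⟨s', t, e, hv, hfr, ht, hsz⟩ := hp U O w X hX s hs
  have := Val.size_hd_le hX.one_le (f U O fun a => s (ρ a))
  refine ⟨_, _, Exec.seq e (Exec.assign _ _ _), by simp [Expr.eval, hv],
    fun i hi => by simp [hi.ne, hfr i hi], ?_, ?_⟩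
  · simp [Expr.cost, Expr.eval, hv]; omega
  · simp; omega

theorem tl (hf : PolyTime f) : PolyTime (L := L) fun U _ O σ => (f U O σ).tl := by
  intro ρ N hρ
  obtain ⟨p, τ, hp⟩ := hf ρ N hρ
  refine ⟨.seq p (.assign N (.tl (.var N))), 3 * τ + 1, fun U _ O w X hX s hs => ?_⟩
  obtain ⟨s', t, e, hv, hfr, ht, hsz⟩ := hp U O w X hX s hs
  have := Val.size_tl_le hX.one_le (f U O fun a => s (ρ a))
  refine ⟨_, _, Exec.seq e (Exec.assign _ _ _), by simp [Expr.eval, hv],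
    fun i hi => by simp [hi.ne, hfr i hi], ?_, ?_⟩
  · simp [Expr.cost, Expr.eval, hv]; omega
  · simp; omega

theorem cons (hf : PolyTime f) (hg : PolyTime g) :
    PolyTime (L := L) fun U _ O σ => .cons (f U O σ) (g U O σ) := by
  intro ρ N hρ
  obtain ⟨p, τ, hp⟩ := hf ρ N hρ
  obtain ⟨p', τ', hp'⟩ := hg ρ (N + 1) fun a => (hρ a).trans N.lt_succ_self
  refine ⟨.seq p (.seq p' (.assign N (.cons (.var N) (.var (N + 1))))), 3 * τ + 3 * τ' + 2,
    fun U _ O w X hX s hs => ?_⟩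
  obtain ⟨s₁, t₁, e₁, hv₁, hfr₁, ht₁, hsz₁⟩ := hp U O w X hX s hs
  have hs₁ : ∀ a, s₁ (ρ a) = s (ρ a) := fun a => hfr₁ _ (hρ a)
  obtain ⟨s₂, t₂, e₂, hv₂, hfr₂, ht₂, hsz₂⟩ := hp' U O w X hX s₁ (by simpa [hs₁] using hs)
  simp only [hs₁] at hv₂ hsz₂
  have hN := hfr₂ N N.lt_succ_self
  refine ⟨_, _, Exec.seq e₁ (Exec.seq e₂ (Exec.assign _ _ _)), by simp [Expr.eval, hv₁, hv₂, hN],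
    fun i hi => by simp [hi.ne, hfr₂ i (by omega), hfr₁ i hi], ?_, ?_⟩
  · simp [Expr.cost, Expr.eval, hv₁, hv₂, hN, Val.size]; omega
  · simp [Val.size]; omega

open Classical in
theorem eq (hf : PolyTime f) (hg : PolyTime g) :
    PolyTime (L := L) fun U _ O σ => .ofBool (decide (f U O σ = g U O σ)) := by
  intro ρ N hρ
  obtain ⟨p, τ, hp⟩ := hf ρ N hρ
  obtain ⟨p', τ', hp'⟩ := hg ρ (N + 1) fun a => (hρ a).trans N.lt_succ_self
  refine ⟨.seq p (.seq p' (.assign N (.eq (.var N) (.var (N + 1))))), 3 * τ + 3 * τ' + 4,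
    fun U _ O w X hX s hs => ?_⟩
  obtain ⟨s₁, t₁, e₁, hv₁, hfr₁, ht₁, hsz₁⟩ := hp U O w X hX s hs
  have hs₁ : ∀ a, s₁ (ρ a) = s (ρ a) := fun a => hfr₁ _ (hρ a)
  obtain ⟨s₂, t₂, e₂, hv₂, hfr₂, ht₂, hsz₂⟩ := hp' U O w X hX s₁ (by simpa [hs₁] using hs)
  simp only [hs₁] at hv₂ hsz₂
  have hN := hfr₂ N N.lt_succ_self
  have hb := Val.size_ofBool_le (U := U) w
    (decide ((f U O fun a => s (ρ a)) = g U O fun a => s (ρ a)))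
  refine ⟨_, _, Exec.seq e₁ (Exec.seq e₂ (Exec.assign _ _ _)), by simp [Expr.eval, hv₁, hv₂, hN],
    fun i hi => by simp [hi.ne, hfr₂ i (by omega), hfr₁ i hi], ?_, ?_⟩
  · simp only [Expr.cost, Expr.eval, hv₁, hv₂, hN, Polynomial.eval_add, Polynomial.eval_mul,
      Polynomial.eval_ofNat]
    omega
  · simp only [Polynomial.eval_add, Polynomial.eval_mul, Polynomial.eval_ofNat]
    omega

open Classical in
theorem ite (hf : PolyTime f) (hg : PolyTime g) (hh : PolyTime h) :
    PolyTime (L := L) fun U _ O σ => if f U O σ = .nil then h U O σ else g U O σ := by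
  intro ρ N hρ
  obtain ⟨p, τ, hp⟩ := hf ρ N hρ
  obtain ⟨p', τ', hp'⟩ := hg ρ N hρ
  obtain ⟨p'', τ'', hp''⟩ := hh ρ N hρ
  refine ⟨.seq p (.ite N p' p''), τ + τ' + τ'' + 1, fun U _ O w X hX s hs => ?_⟩
  obtain ⟨s₁, t₁, e₁, hv₁, hfr₁, ht₁, hsz₁⟩ := hp U O w X hX s hs
  have hs₁ : ∀ a, s₁ (ρ a) = s (ρ a) := fun a => hfr₁ _ (hρ a)
  by_cases hc : (f U O fun a => s (ρ a)) = .nil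
  · obtain ⟨s₂, t₂, e₂, hv₂, hfr₂, ht₂, hsz₂⟩ := hp'' U O w X hX s₁ (by simpa [hs₁] using hs)
    simp only [hs₁] at hv₂ hsz₂
    refine ⟨_, _, Exec.seq e₁ (Exec.ite_false (hv₁.trans hc) e₂), by simp [hc, hv₂],
      fun i hi => by rw [hfr₂ i hi, hfr₁ i hi], ?_, ?_⟩
    · simp; omega
    · simp [hc]; omega
  · obtain ⟨s₂, t₂, e₂, hv₂, hfr₂, ht₂, hsz₂⟩ := hp' U O w X hX s₁ (by simpa [hs₁] using hs)
    simp only [hs₁] at hv₂ hsz₂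
    refine ⟨_, _, Exec.seq e₁ (Exec.ite_true (by rwa [hv₁]) e₂), by simp [hc, hv₂],
      fun i hi => by rw [hfr₂ i hi, hfr₁ i hi], ?_, ?_⟩
    · simp; omega
    · simp [hc]; omega

theorem nbrs (hf : PolyTime f) : PolyTime (L := L) fun U _ O σ => nbrAnswer O (f U O σ) := by
  intro ρ N hρ
  obtain ⟨p, τ, hp⟩ := hf ρ N hρ
  refine ⟨.seq p (.nbrs N N), τ + Polynomial.X * (1 + Polynomial.X) + 2,
    fun U _ O w X hX s hs => ?_⟩
  obtain ⟨s', t, e, hv, hfr, ht, hsz⟩ := hp U O w X hX s hs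
  have hb : ∀ v : Val U, (nbrAnswer O v).size w ≤ 1 + X * (1 + X) := by
    intro v
    cases v with
    | nil => simp [nbrAnswer, Val.size]
    | cons a b => simp [nbrAnswer, Val.size]
    | elem u =>
      refine Val.size_ofList_le ?_ (by simpa using hX.length_le u)
      simp only [List.mem_map]
      rintro _ ⟨v, -, rfl⟩
      exact hX.le
  have := hb (f U O fun a => s (ρ a))
  refine ⟨_, _, Exec.seq e (Exec.nbrs _ _ _), by simp [hv],
    fun i hi => by simp [hi.ne, hfr i hi], ?_, ?_⟩
  · simp [hv]; omega
  · simp; omega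

open Classical in
theorem rel {n : ℕ} (R : L.Relations n) (xs : Fin n → α) : PolyTime (L := L) fun U _ _ σ =>
    .ofBool (decide (∃ u : Fin n → U, (∀ i, σ (xs i) = .elem (u i)) ∧ RelMap R u)) := by
  intro ρ N hρ
  refine ⟨.rel N R (fun i => ρ (xs i)), 3, fun U _ O w X hX s hs => ?_⟩
  refine ⟨_, _, Exec.rel _ _ _ _, by simp [relAnswer], fun i hi => by simp [hi.ne], ?_, ?_⟩
  · simp
  · simpa using Val.size_ofBool_le w _

/-- The intermediate value stays in register `N` while the second program works from `N + 1` on. It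
may have size `τ`, whence the argument `X + τ` of `τ'`. -/
theorem bind {g : Family L (Option α)} (hf : PolyTime f) (hg : PolyTime g) :
    PolyTime (L := L) fun U _ O σ => g U O (ext σ (f U O σ)) := by
  intro ρ N hρ
  obtain ⟨p, τ, hp⟩ := hf ρ N hρ
  obtain ⟨p', τ', hp'⟩ := hg (ext ρ N) (N + 1) (by
    rintro (_ | a)
    · simp
    · simpa using (hρ a).trans N.lt_succ_self)
  refine ⟨.seq p (.seq p' (.assign N (.var (N + 1)))), τ + 2 * τ'.comp (Polynomial.X + τ) + 1,
    fun U _ O w X hX s hs => ?_⟩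
  obtain ⟨s₁, t₁, e₁, hv₁, hfr₁, ht₁, hsz₁⟩ := hp U O w X hX s hs
  have hs₁ : (fun a => s₁ (ext ρ N a)) = ext (fun a => s (ρ a)) (f U O fun a => s (ρ a)) := by
    funext a
    cases a with
    | none => exact hv₁
    | some a => exact hfr₁ _ (hρ a)
  obtain ⟨s₂, t₂, e₂, hv₂, hfr₂, ht₂, hsz₂⟩ := hp' U O w (X + τ.eval X)
    (hX.mono (Nat.le_add_right _ _)) s₁ (by
      intro a
      rw [congrFun hs₁ a]
      cases a with
      | none => exact hsz₁.trans (Nat.le_add_left _ _)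
      | some a => exact (hs a).trans (Nat.le_add_right _ _))
  rw [hs₁] at hv₂ hsz₂
  refine ⟨_, _, Exec.seq e₁ (Exec.seq e₂ (Exec.assign _ _ _)), by simp [Expr.eval, hv₂],
    fun i hi => by simp [hi.ne, hfr₂ i (by omega), hfr₁ i hi], ?_, ?_⟩
  · simp [Expr.cost, hv₂]; omega
  · simp; omega

/-- The list comprehension `[b | a ∈ f, b ∈ g a]`, in reverse order. -/
theorem flatMap {g : Family L (Option α)} (hf : PolyTime f) (hg : PolyTime g) :
    PolyTime (L := L) fun U _ O σ => .ofList
      (((f U O σ).toList.flatMap fun a => (g U O (ext σ a)).toList).reverse) := by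
  intro ρ N hρ
  obtain ⟨p, τ, hp⟩ := hf ρ N hρ
  -- Registers: `N` the remaining entries, `N + 1` the accumulator, `N + 2` the current entry, `N +
  -- 3` the value of `g`.
  obtain ⟨p', τ', hp'⟩ := hg (ext ρ (N + 2)) (N + 3) (by
    rintro (_ | a)
    · simp
    · have := hρ a
      simp; omega)
  -- `Gp` bounds one value of `g`, whose extra argument is no larger than the list `f`; `Bp` bounds
  -- an accumulator of at most `τ * Gp` entries of that size.
  let Gp : Polynomial ℕ := τ'.comp (Polynomial.X + τ)
  let Bp : Polynomial ℕ := 1 + (τ * Gp) * (1 + Gp)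
  refine ⟨.seq p (.seq (.assign (N + 1) .nil) (.seq (.loop N
      (.seq (.assign (N + 2) (.hd (.var N))) (.seq (.assign N (.tl (.var N)))
        (.seq p' (revAppendProg L (N + 3) (N + 1))))))
      (.assign N (.var (N + 1))))),
    τ + 2 + (τ * ((4 * τ + 2 + Gp + Gp * (2 * Bp + 4 * Gp + 3) + 1) + 1) + 1) + 1 + Bp,
    fun U _ O w X hX s hs => ?_⟩
  obtain ⟨s₁, t₁, e₁, hv₁, hfr₁, ht₁, hsz₁⟩ := hp U O w X hX s hs
  have hw := hX.one_le
  set σ : α → Val U := fun a => s (ρ a) with hσ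
  set F := τ.eval X with hF
  set G := Gp.eval X with hG
  set B := Bp.eval X with hB
  have hBe : B = 1 + (F * G) * (1 + G) := by simp [hB, Bp, hF, hG]
  have hGe : G = τ'.eval (X + F) := by simp [hG, Gp, hF]
  set hh : Val U → List (Val U) := fun a => (g U O (ext σ a)).toList with hhh
  set l₀ := (f U O σ).toList with hl₀
  have hlen₀ : l₀.length ≤ F := (Val.length_toList_le hw _).trans hsz₁
  have hmem₀ : ∀ a ∈ l₀, a.size w ≤ F := fun a ha => (Val.size_le_of_mem_toList hw ha).trans hsz₁
  have grun : ∀ a ∈ l₀, ∀ s₂ : ℕ → Val U, (∀ i < N, s₂ i = s i) → s₂ (N + 2) = a →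
      ∃ s' t, Exec O w p' s₂ s' t ∧ s' (N + 3) = g U O (ext σ a) ∧ (∀ i < N + 3, s' i = s₂ i) ∧
        t ≤ G ∧ (g U O (ext σ a)).size w ≤ G := by
    intro a ha s₂ h1 h2
    have hs₂ : (fun a => s₂ (ext ρ (N + 2) a)) = ext σ a := by
      funext b
      cases b with
      | none => exact h2
      | some b => exact h1 _ (hρ b)
    have := hp' U O w (X + F) (hX.mono (Nat.le_add_right _ _)) s₂ (by
      intro b
      rw [congrFun hs₂ b]
      cases b with
      | none => exact (hmem₀ a ha).trans (Nat.le_add_left _ _)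
      | some b => exact (hs b).trans (Nat.le_add_right _ _))
    rwa [hs₂, ← hGe] at this
  have gsize : ∀ a ∈ l₀, (g U O (ext σ a)).size w ≤ G := by
    intro a ha
    obtain ⟨_, _, _, _, _, _, h⟩ := grun a ha (Function.update s (N + 2) a)
      (fun i hi => by rw [Function.update_of_ne (by omega)]) (by simp)
    exact h
  -- Accumulators caught in the middle of a transfer are suffixes of the completed reversed list.
  have accsize : ∀ l l' : List (Val U), (∀ a ∈ l, a ∈ l₀) → l.length ≤ F →
      l' <:+ (l.flatMap hh).reverse → (Val.ofList l').size w ≤ B := by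
    intro l l' hl hlen hsub
    rw [hBe]
    refine Val.size_ofList_le (fun b hb => ?_) ?_
    · have := hsub.subset hb
      simp only [List.mem_reverse, List.mem_flatMap] at this
      obtain ⟨a, ha, hb⟩ := this
      exact (Val.size_le_of_mem_toList hw hb).trans (gsize a (hl a ha))
    · refine hsub.length_le.trans ?_
      rw [List.length_reverse, List.length_flatMap]
      refine (List.sum_le_card_nsmul _ G ?_).trans ?_
      · simp only [List.mem_map]
        rintro _ ⟨a, ha, rfl⟩
        exact (Val.length_toList_le hw _).trans (gsize a (hl a ha))
      · simpa using Nat.mul_le_mul_right G hlen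
  let I : (ℕ → Val U) → Prop := fun s' => (∀ i < N, s' i = s i) ∧ (s' N).size w ≤ F ∧
    ∃ l, l₀ = l ++ (s' N).toList ∧ s' (N + 1) = .ofList (l.flatMap hh).reverse
  obtain ⟨s₂, t₂, e₂, ⟨hi1, hi2, l, hl, hacc⟩, hnil, ht₂⟩ := exec_loop O w (x := N)
    (C := 4 * F + 2 + G + (G * (2 * B + 4 * G + 3) + 1))
    (p := .seq (.assign (N + 2) (.hd (.var N))) (.seq (.assign N (.tl (.var N)))
        (.seq p' (revAppendProg L (N + 3) (N + 1))))) I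
    (by
      rintro s₂ ⟨h1, h2, l, hl, hacc⟩ hne
      rw [Val.toList_of_ne_nil hne] at hl
      set a := (s₂ N).hd with ha
      have hal : a ∈ l₀ := by simp [hl]
      obtain ⟨s₃, t₃, e₃, hv₃, hfr₃, ht₃, hsz₃⟩ := grun a hal
        (Function.update (Function.update s₂ (N + 2) a) N (s₂ N).tl)
        (fun i hi => by simp [hi.ne, show i ≠ N + 2 by omega, h1 i hi]) (by simp)
      have hacc₃ : s₃ (N + 1) = .ofList (l.flatMap hh).reverse := by
        rw [hfr₃ _ (by omega)]; simpa using hacc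
      have hN₃ : s₃ N = (s₂ N).tl := by
        rw [hfr₃ _ (by omega)]; simp
      obtain ⟨s₄, t₄, e₄, hv₄, hfr₄, ht₄⟩ := exec_revAppend O hw (x := N + 3) (y := N + 1)
        (by omega) s₃ _ hacc₃ (B := B) (G := G) (by
          intro l₁ l₂ h12
          refine accsize (l ++ [a]) _ ?_ ?_ ?_
          · intro b hb
            rw [hl]
            simp only [List.mem_append, List.mem_singleton] at hb
            rcases hb with hb | rfl <;> simp [*]
          · refine le_trans ?_ hlen₀
            rw [hl]; simp
          · rw [hv₃] at h12
            simp only [List.flatMap_append, List.flatMap_singleton, List.reverse_append, hhh, h12]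
            exact ⟨l₂.reverse, by simp⟩) (by rw [hv₃]; exact hsz₃)
      refine ⟨s₄, _, Exec.seq (Exec.assign _ _ _) (Exec.seq (Exec.assign _ _ _)
        (Exec.seq (by simpa [Expr.eval] using e₃) e₄)), ⟨?_, ?_, l ++ [a], ?_, ?_⟩, ?_, ?_⟩
      · intro i hi
        rw [hfr₄ i (by omega) (by omega), hfr₃ i (by omega)]
        simp [hi.ne, show i ≠ N + 2 by omega, h1 i hi]
      · rw [hfr₄ N (by omega) (by omega), hN₃]
        exact (Val.size_tl_le hw _).trans h2
      · rw [hfr₄ N (by omega) (by omega), hN₃, hl]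
        simp
      · rw [hv₄, hv₃]
        simp [hhh]
      · rw [hfr₄ N (by omega) (by omega), hN₃, Val.toList_of_ne_nil hne]
        simp
      · have b1 := Val.size_hd_le hw (s₂ N)
        have b2 := Val.size_tl_le hw (s₂ N)
        simp [Expr.cost, Expr.eval]
        omega)
    (Function.update s₁ (N + 1) .nil)
    ⟨fun i hi => by simp [show i ≠ N + 1 by omega, hfr₁ i hi], by simpa [hv₁] using hsz₁, [],
      by simp [hv₁, l₀], by simp [Val.ofList]⟩
  have hl' : l = l₀ := by
    rw [hnil] at hl
    simpa [Val.toList] using hl.symm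
  have hfin : s₂ (N + 1) = .ofList (l₀.flatMap hh).reverse := by rw [hacc, hl']
  have hres : (Val.ofList (l₀.flatMap hh).reverse).size w ≤ B :=
    accsize l₀ _ (fun _ h => h) hlen₀ (List.suffix_refl _)
  refine ⟨_, _, Exec.seq e₁ (Exec.seq (Exec.assign _ _ _) (Exec.seq (by simpa [Expr.eval] using e₂)
    (Exec.assign _ _ _))), by simp [Expr.eval, hfin]; rfl, fun i hi => by simp [hi.ne, hi1 i hi], ?_, ?_⟩
  · have : ((Function.update s₁ (N + 1) Val.nil : ℕ → Val U) N).toList.length ≤ F := by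
      simpa [hv₁] using hlen₀
    have h2 := ht₂.trans (Nat.add_le_add_right (Nat.mul_le_mul_right _ this) 1)
    simp only [Expr.cost, hfin, Polynomial.eval_add, Polynomial.eval_mul, Polynomial.eval_ofNat,
      Polynomial.eval_one, ← hF, ← hG, ← hB]
    simp only [← Nat.add_assoc] at h2 ⊢
    omega
  · simp only [Polynomial.eval_add, ← hB]
    exact hres.trans (Nat.le_add_left _ _)

/-- Removing as many entries from a list as another list has. -/
theorem drop (hf : PolyTime f) (hg : PolyTime g) :
    PolyTime (L := L) fun U _ O σ => Val.tl^[(f U O σ).toList.length] (g U O σ) := by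
  intro ρ N hρ
  obtain ⟨p, τ, hp⟩ := hf ρ N hρ
  obtain ⟨p', τ', hp'⟩ := hg ρ (N + 1) fun a => (hρ a).trans N.lt_succ_self
  refine ⟨.seq p (.seq p' (.seq (.loop N
      (.seq (.assign N (.tl (.var N))) (.assign (N + 1) (.tl (.var (N + 1))))))
      (.assign N (.var (N + 1))))), τ + τ' + (τ * (2 * τ + 2 * τ' + 2 + 1) + 1) + 1 + τ',
    fun U _ O w X hX s hs => ?_⟩
  obtain ⟨s₁, t₁, e₁, hv₁, hfr₁, ht₁, hsz₁⟩ := hp U O w X hX s hs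
  have hs₁ : ∀ a, s₁ (ρ a) = s (ρ a) := fun a => hfr₁ _ (hρ a)
  obtain ⟨s₂, t₂, e₂, hv₂, hfr₂, ht₂, hsz₂⟩ := hp' U O w X hX s₁ (by simpa [hs₁] using hs)
  simp only [hs₁] at hv₂ hsz₂
  have hN : s₂ N = _ := (hfr₂ N N.lt_succ_self).trans hv₁
  have hw := hX.one_le
  set a := f U O fun a => s (ρ a)
  set b := g U O fun a => s (ρ a)
  obtain ⟨s₃, t₃, e₃, ⟨h1, h2, h3, h4⟩, hnil, ht₃⟩ := exec_loop O w (x := N)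
    (C := 2 * τ.eval X + 2 * τ'.eval X + 2)
    (p := .seq (.assign N (.tl (.var N))) (.assign (N + 1) (.tl (.var (N + 1)))))
    (fun s' => (∀ i < N, s' i = s i) ∧ (s' N).size w ≤ τ.eval X ∧
      (s' (N + 1)).size w ≤ τ'.eval X ∧
      Val.tl^[(s' N).toList.length] (s' (N + 1)) = Val.tl^[a.toList.length] b)
    (by
      rintro s' ⟨h1, h2, h3, h4⟩ hne
      have b1 := Val.size_tl_le hw (s' N)
      have b2 := Val.size_tl_le hw (s' (N + 1))
      refine ⟨_, _, Exec.seq (Exec.assign _ _ _) (Exec.assign _ _ _), ⟨?_, ?_, ?_, ?_⟩, ?_, ?_⟩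
      · intro i hi
        simp [hi.ne, show i ≠ N + 1 by omega, h1 i hi]
      · simpa [Expr.eval] using b1.trans h2
      · simpa [Expr.eval] using b2.trans h3
      · rw [← h4, Val.toList_of_ne_nil hne]
        simp [Expr.eval]
      · simp [Expr.eval, Val.toList_of_ne_nil hne]
      · simp [Expr.cost, Expr.eval]
        omega)
    s₂ ⟨fun i hi => by rw [hfr₂ i (by omega), hfr₁ i hi], by rw [hN]; exact hsz₁,
      by rw [hv₂]; exact hsz₂, by rw [hN, hv₂]⟩
  rw [hnil] at h4
  simp only [Val.toList, List.length_nil, Function.iterate_zero, id] at h4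
  refine ⟨_, _, Exec.seq e₁ (Exec.seq e₂ (Exec.seq e₃ (Exec.assign _ _ _))),
    by simp [Expr.eval, h4]; rfl, fun i hi => by simp [hi.ne, h1 i hi], ?_, ?_⟩
  · have : (s₂ N).toList.length ≤ τ.eval X := by
      rw [hN]; exact (Val.length_toList_le hw _).trans hsz₁
    have h5 := ht₃.trans (Nat.add_le_add_right (Nat.mul_le_mul_right _ this) 1)
    simp only [Expr.cost, Polynomial.eval_add, Polynomial.eval_mul, Polynomial.eval_ofNat,
      Polynomial.eval_one]
    omega
  · change (Val.tl^[a.toList.length] b).size w ≤ _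
    rw [← h4]
    simp only [Polynomial.eval_add]
    omega

end PolyTime

/-! ### Decoding and injectivity of the encodings. -/

namespace Val

variable {U : Type}

theorem ofList_eq_nil {l : List (Val U)} : ofList l = nil ↔ l = [] := by
  cases l <;> simp [ofList]

theorem ofBool_eq_nil {b : Bool} : (ofBool b : Val U) = nil ↔ b = false := by
  cases b <;> simp [ofBool]

theorem ofBool_injective : Function.Injective (ofBool : Bool → Val U) := by
  intro a b h
  cases a <;> cases b <;> simp_all [ofBool]

theorem hd_mem_toList {v : Val U} (h : v.toList ≠ []) : v.hd ∈ v.toList := by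
  have : v ≠ nil := by rintro rfl; exact h rfl
  rw [toList_of_ne_nil this]
  exact List.mem_cons_self

/-- This turns `PolyTime.drop` into a comparison of list lengths. -/
theorem iterate_tl_eq_nil {n : ℕ} {v : Val U} : tl^[n] v = nil ↔ v.toList.length ≤ n := by
  induction n generalizing v with
  | zero => cases v <;> simp [toList]
  | succ n ih =>
    rw [Function.iterate_succ_apply, ih]
    cases v <;> simp [toList, tl]

theorem hd_iterate_tl_ofList (l : List (Val U)) (i : ℕ) (hi : i < l.length) :
    (tl^[i] (ofList l)).hd = l[i] := by
  induction l generalizing i with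
  | nil => simp at hi
  | cons a l ih =>
    cases i with
    | zero => rfl
    | succ i => simpa [ofList, tl] using ih i (by simpa using hi)

theorem hd_iterate_tl_ofTuple {m : ℕ} (u : Fin m → U) (i : Fin m) :
    (tl^[i] (ofTuple u)).hd = elem (u i) := by
  rw [ofTuple, hd_iterate_tl_ofList _ _ (by simp)]
  simp

theorem ofTuple_cons {m : ℕ} (x : U) (u : Fin m → U) :
    ofTuple (Fin.cons x u : Fin (m + 1) → U) = cons (elem x) (ofTuple u) := by
  simp [ofTuple, ofList]

theorem ofNat_injective : Function.Injective (ofNat : ℕ → Val U) := by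
  intro a b h
  induction a generalizing b with
  | zero => cases b <;> simp_all [ofNat]
  | succ a ih =>
    cases b with
    | zero => simp [ofNat] at h
    | succ b =>
      simp only [ofNat, cons.injEq, true_and] at h
      rw [ih h]

theorem ofList_injective : Function.Injective (ofList : List (Val U) → Val U) := fun a b h => by
  simpa using congrArg toList h

theorem ofVar_injective {k l n : ℕ} :
    Function.Injective (ofVar : (Fin k ⊕ Fin l) ⊕ Fin n → Val U) := by
  rintro ((i | i) | i) ((j | j) | j) h <;>
    simp only [ofVar, cons.injEq, ofNat_injective.eq_iff] at h <;> simp_all [Fin.ext_iff]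

theorem ofTerm_injective {L : FirstOrder.Language.{0, 0}} [L.IsRelational] {k l n : ℕ} :
    Function.Injective (ofTerm : L.Term ((Fin k ⊕ Fin l) ⊕ Fin n) → Val U) := by
  rintro (x | ⟨f, _⟩) (y | ⟨g, _⟩) h
  · exact congrArg _ (ofVar_injective h)
  · exact isEmptyElim g
  · exact isEmptyElim f
  · exact isEmptyElim f

/-- This lets the evaluator recognise a hypothesis by comparing codes. -/
theorem ofFormula_injective {L : FirstOrder.Language.{0, 0}} [L.IsRelational]
    [Encodable (Σ n, L.Relations n)] {k l n : ℕ} {φ ψ : L.BoundedFormula (Fin k ⊕ Fin l) n}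
    (h : (ofFormula φ : Val U) = ofFormula ψ) : φ = ψ := by
  induction φ with
  | falsum => cases ψ <;> simp [ofFormula, ofNat] at h ⊢
  | equal s t =>
    cases ψ <;> simp [ofFormula, ofNat, ofTerm_injective.eq_iff] at h ⊢
    exact h
  | rel R ts =>
    cases ψ <;> simp only [ofFormula, cons.injEq, ofNat_injective.eq_iff,
      Encodable.encode_inj] at h <;> try omega
    obtain ⟨-, h1, h2⟩ := h
    injection h1 with h1 h3
    subst h1
    obtain rfl := eq_of_heq h3
    have h4 := List.ofFn_injective (ofList_injective h2)
    congr
    funext i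
    exact ofTerm_injective (congrFun h4 i)
  | imp φ ψ ih1 ih2 =>
    cases ψ with
    | imp φ' ψ' =>
      simp only [ofFormula, cons.injEq, true_and] at h
      rw [ih1 h.1, ih2 h.2]
    | _ => simp [ofFormula, ofNat] at h
  | all φ ih =>
    cases ψ with
    | all φ' =>
      simp only [ofFormula, cons.injEq, true_and] at h
      rw [ih h]
    | _ => simp [ofFormula, ofNat] at h

end Val

/-! ### List search and evaluation of guarded formulas. -/

namespace PolyTime

variable {L : FirstOrder.Language.{0, 0}} {α β : Type}

theorem true_ : PolyTime (L := L) (α := α) fun _ _ _ _ => .ofBool true := cons nil nil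

/-- Substitution is iterated `bind`; the summand `β` keeps the original arguments available to the
functions still to be computed. -/
theorem substAux (n : ℕ) {β : Type} (f : Family L (β ⊕ Fin n)) (g : Fin n → Family L β)
    (hf : PolyTime f) (hg : ∀ i, PolyTime (g i)) :
    PolyTime (L := L) fun U _ O σ => f U O (Sum.elim σ fun i => g i U O σ) := by
  induction n generalizing β with
  | zero =>
    convert hf.comp_map (fun s : β ⊕ Fin 0 => s.elim id Fin.elim0) using 6 with U _ O σ
    funext s
    rcases s with s | s
    · rfl
    · exact s.elim0
  | succ n ih =>
    let e : β ⊕ Fin (n + 1) → Option β ⊕ Fin n := fun s => s.elim (fun b => Sum.inl (some b))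
      (Fin.lastCases (Sum.inl none) Sum.inr)
    have := (hg (Fin.last n)).bind (ih _ (fun i => fun U _ O σ => g i.castSucc U O fun b => σ (some b))
      (hf.comp_map e) fun i => (hg i.castSucc).comp_map some)
    convert this using 6 with U _ O σ
    funext s
    rcases s with s | s
    · rfl
    · refine Fin.lastCases ?_ (fun j => ?_) s <;> simp [e]

/-- Substitution. -/
theorem subst {n : ℕ} {f : Family L (Fin n)} {g : Fin n → Family L β}
    (hf : PolyTime f) (hg : ∀ i, PolyTime (g i)) :
    PolyTime (L := L) fun U _ O σ => f U O fun i => g i U O σ :=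
  substAux n _ g (hf.comp_map Sum.inr) hg

theorem get {f : Family L α} (hf : PolyTime f) (i : ℕ) :
    PolyTime (L := L) fun U _ O σ => (Val.tl^[i] (f U O σ)).hd := by
  suffices h : PolyTime (L := L) fun U _ O σ => Val.tl^[i] (f U O σ) from h.hd
  induction i with
  | zero => exact hf
  | succ i ih =>
    simp only [Function.iterate_succ_apply']
    exact ih.tl

theorem ofNat (n : ℕ) : PolyTime (L := L) (α := α) fun _ _ _ _ => .ofNat n := by
  induction n with
  | zero => exact nil
  | succ n ih => exact nil.cons ih

theorem ofList {n : ℕ} {f : Fin n → Family L α} (hf : ∀ i, PolyTime (f i)) :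
    PolyTime (L := L) fun U _ O σ => .ofList (List.ofFn fun i => f i U O σ) := by
  induction n with
  | zero => simpa [Val.ofList] using nil
  | succ n ih =>
    simp only [List.ofFn_succ, Val.ofList]
    exact (hf 0).cons (ih fun i => hf i.succ)

theorem ofFormula [L.IsRelational] [Encodable (Σ n, L.Relations n)] {k l n : ℕ}
    (φ : L.BoundedFormula (Fin k ⊕ Fin l) n) :
    PolyTime (L := L) (α := α) fun _ _ _ _ => .ofFormula φ := by
  have term : ∀ {n : ℕ} (t : L.Term ((Fin k ⊕ Fin l) ⊕ Fin n)),
      PolyTime (L := L) (α := α) fun _ _ _ _ => .ofTerm t := by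
    rintro n (((i | i) | i) | ⟨f, _⟩)
    · exact (ofNat 0).cons (ofNat i)
    · exact (ofNat 1).cons (ofNat i)
    · exact (ofNat 2).cons (ofNat i)
    · exact isEmptyElim f
  induction φ with
  | falsum => exact (ofNat 0).cons nil
  | equal s t => exact (ofNat 1).cons ((term s).cons (term t))
  | rel R ts => exact (ofNat 2).cons ((ofNat _).cons (ofList fun i => term (ts i)))
  | imp φ ψ ih1 ih2 => exact (ofNat 3).cons (ih1.cons ih2)
  | all φ ih => exact (ofNat 4).cons ih

theorem append {f g : Family L α} (hf : PolyTime f) (hg : PolyTime g) :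
    ∃ h : Family L α, PolyTime h ∧ ∀ (U : Type) [L.Structure U] (O : NbrOracle L U) σ a,
      a ∈ (h U O σ).toList ↔ a ∈ (f U O σ).toList ∨ a ∈ (g U O σ).toList := by
  refine ⟨_, (hf.cons (hg.cons nil)).flatMap (var none), fun U _ O σ a => ?_⟩
  simp [Val.toList, or_comm]

/-- An entry of a list whose head is a list of minimal length. -/
theorem exists_argmin {C : Family L α} (hC : PolyTime C) :
    ∃ b : Family L α, PolyTime b ∧ ∀ (U : Type) [L.Structure U] (O : NbrOracle L U) σ,
      (C U O σ).toList ≠ [] → b U O σ ∈ (C U O σ).toList ∧ ∀ c ∈ (C U O σ).toList,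
        (b U O σ).hd.toList.length ≤ c.hd.toList.length := by
  classical
  obtain ⟨better, hb, hspec⟩ : ∃ f : Family L (Option α), PolyTime f ∧
      ∀ (U : Type) [L.Structure U] (O : NbrOracle L U) σ c, f U O (ext σ c) = .nil ↔
        ∀ c' ∈ (C U O σ).toList, c.hd.toList.length ≤ c'.hd.toList.length := by
    -- The comprehension leaves a mark for each `c'` whose head is strictly shorter than that of
    -- `c`, so it is `nil` exactly when `c` is minimal.
    refine ⟨_, (hC.comp_map (some : α → Option α)).flatMap
      (ite ((var (L := L) none).hd.drop (var (L := L) (some none)).hd) true_ nil),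
      fun U _ O σ c => ?_⟩
    simp only [Val.ofList_eq_nil, List.reverse_eq_nil_iff, List.flatMap_eq_nil_iff, ext_none,
      ext_some, Val.iterate_tl_eq_nil]
    refine forall₂_congr fun c' _ => ?_
    split_ifs with h <;> simp [Val.toList, Val.ofBool, h]
  refine ⟨_, (hC.flatMap (ite hb nil ((var (L := L) none).cons nil))).hd,
    fun U _ O σ hne => ?_⟩
  have mem : ∀ b, b ∈ (Val.ofList (((C U O σ).toList.flatMap fun a =>
      (if better U O (ext σ a) = .nil then Val.cons (ext σ a none) .nil else .nil).toList).reverse)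
        ).toList ↔ b ∈ (C U O σ).toList ∧ ∀ c' ∈ (C U O σ).toList,
          b.hd.toList.length ≤ c'.hd.toList.length := by
    intro b
    simp only [Val.toList_ofList, List.mem_reverse, List.mem_flatMap, hspec]
    constructor
    · rintro ⟨c, hc, h⟩
      split_ifs at h with h'
      · obtain rfl : b = c := by simpa [Val.toList] using h
        exact ⟨hc, h'⟩
      · simp [Val.toList] at h
    · rintro ⟨hc, h⟩
      exact ⟨b, hc, by rw [if_pos h]; simp [Val.toList]⟩
  refine (mem _).1 (Val.hd_mem_toList ?_)
  obtain ⟨c, hc, hmin⟩ := Finset.exists_min_image (C U O σ).toList.toFinset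
    (fun c => c.hd.toList.length) (by simpa using hne)
  exact List.ne_nil_of_mem ((mem c).2 ⟨by simpa using hc, by simpa using hmin⟩)

open Classical in
/-- Guarded formulas can be evaluated in polynomial time. -/
theorem exists_sat {n : ℕ} (χ : GFormula L n) : ∃ f : Family L (Fin n), PolyTime f ∧
    ∀ (U : Type) [L.Structure U] (O : NbrOracle L U) (u : Fin n → U),
      f U O (fun i => .elem (u i)) = .ofBool (decide (χ.Sat u)) := by
  induction χ with
  | falsum => exact ⟨_, nil, fun U _ O u => by
      symm; rw [Val.ofBool_eq_nil, decide_eq_false_iff_not]; exact id⟩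
  | rel R xs =>
    refine ⟨_, rel R xs, fun U _ O u => ?_⟩
    congr 1
    rw [decide_eq_decide]
    constructor
    · rintro ⟨v, hv, h⟩
      obtain rfl : v = u ∘ xs := funext fun i => by injection (hv i).symm
      exact h
    · exact fun h => ⟨u ∘ xs, fun i => rfl, h⟩
  | equal i j => exact ⟨_, eq (var i) (var j), fun U _ O u => by
      congr 1; rw [decide_eq_decide]; simp [GFormula.Sat]⟩
  | imp φ ψ ih1 ih2 =>
    obtain ⟨f, hf, h1⟩ := ih1
    obtain ⟨g, hg, h2⟩ := ih2
    refine ⟨_, ite hf hg true_, fun U _ O u => ?_⟩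
    simp only [h1, h2, Val.ofBool_eq_nil, decide_eq_false_iff_not, GFormula.Sat]
    by_cases h : φ.Sat u <;> simp [h]
  | @ex n i φ ih =>
    obtain ⟨f, hf, h1⟩ := ih
    let e : Fin (n + 1) → Option (Fin n) := Fin.lastCases none some
    -- One neighbourhood query lists the whole range of the guarded quantifier; each witness leaves
    -- a mark.
    refine ⟨_, ite (((var i).cons (var i).nbrs).flatMap (ite (hf.comp_map e) true_ nil))
      true_ nil, fun U _ O u => ?_⟩
    have key : ∀ z, f U O (fun a => ext (fun i => Val.elem (u i)) (Val.elem z) (e a)) =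
        .ofBool (decide (φ.Sat (Fin.snoc u z : Fin _ → U))) := by
      intro z
      rw [← h1]
      congr 1
      funext a
      refine Fin.lastCases ?_ (fun a => ?_) a <;> simp [e]
    have nb : (nbrAnswer O (Val.elem (u i))).toList = (O.list (u i)).map Val.elem := by
      simp [nbrAnswer]
    have emp : ∀ z, (if f U O (fun a => ext (fun i => Val.elem (u i)) (Val.elem z) (e a)) = .nil
        then (Val.nil : Val U) else .ofBool true).toList = [] ↔
          ¬ φ.Sat (Fin.snoc u z : Fin _ → U) := by
      intro z
      rw [key, Val.ofBool_eq_nil]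
      by_cases h : φ.Sat (Fin.snoc u z : Fin _ → U) <;> simp [h, Val.toList, Val.ofBool]
    have all : (Val.ofList (((Val.cons (Val.elem (u i)) (nbrAnswer O (Val.elem (u i)))).toList.flatMap
        fun z => (if f U O (fun a => ext (fun i => Val.elem (u i)) z (e a)) = .nil
          then (Val.nil : Val U) else .ofBool true).toList).reverse)) = .nil ↔
        ¬ (GFormula.ex i φ).Sat u := by
      simp only [Val.ofList_eq_nil, List.reverse_eq_nil_iff, List.flatMap_eq_nil_iff, Val.toList,
        nb, List.mem_cons, List.mem_map, forall_eq_or_imp, forall_exists_index, and_imp,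
        forall_apply_eq_imp_iff₂, emp, O.mem_list, GFormula.Sat, Close, not_exists, not_and]
    simp only [all]
    by_cases h : (GFormula.ex i φ).Sat u <;> simp [h, Val.ofBool]

end PolyTime

/-! ### The learner and the evaluator. -/

theorem near_succ' {L : FirstOrder.Language.{0, 0}} {U : Type} [L.Structure U] {r : ℕ} {x y : U} :
    Near L (r + 1) x y ↔ ∃ z, Near L r x z ∧ Close L z y := by
  constructor
  · intro h
    obtain ⟨z, hz, h⟩ := h.symm
    exact ⟨z, h.symm, hz.symm⟩
  · rintro ⟨z, hz, h⟩
    exact hz.trans (near_one.2 h)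

namespace Val

variable {U : Type}

theorem toList_ofTuple {m : ℕ} (u : Fin m → U) :
    (ofTuple u).toList = List.ofFn fun i => elem (u i) := by
  rw [ofTuple, toList_ofList]

theorem toList_ofTraining {k : ℕ} (T : List ((Fin k → U) × Bool)) :
    (ofTraining T).toList = T.map fun p => cons (ofTuple p.1) (ofBool p.2) := by
  rw [ofTraining, toList_ofList]

theorem size_ofTuple_le {m w : ℕ} (u : Fin m → U) : (ofTuple u).size w ≤ 1 + m * (1 + w) := by
  refine size_ofList_le (fun a ha => ?_) (by simp)
  obtain ⟨i, rfl⟩ := (List.mem_ofFn' _ _).1 ha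
  exact le_rfl

theorem size_ofTraining_le {k w : ℕ} (T : List ((Fin k → U) × Bool)) :
    (ofTraining T).size w ≤ 1 + T.length * (1 + (1 + (1 + k * (1 + w)) + 3)) := by
  refine size_ofList_le (fun a ha => ?_) (by simp)
  obtain ⟨p, -, rfl⟩ := List.mem_map.1 ha
  exact Nat.add_le_add (Nat.add_le_add_left (size_ofTuple_le _) 1) (size_ofBool_le _ _)

end Val

namespace PolyTime

variable {L : FirstOrder.Language.{0, 0}} {α β : Type}

/-- The elements in the `R`-neighbourhood of the training examples. -/
theorem exists_ball (L : FirstOrder.Language.{0, 0}) (k R : ℕ) :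
    ∃ f : Family L Unit, PolyTime f ∧ ∀ (U : Type) [L.Structure U] (O : NbrOracle L U)
      (T : List ((Fin k → U) × Bool)) (v : Val U), v ∈ (f U O fun _ => .ofTraining T).toList ↔
        ∃ p ∈ T, ∃ a y, Near L R (p.1 a) y ∧ v = .elem y := by
  induction R with
  | zero =>
    refine ⟨_, (var ()).flatMap (var (L := L) none).hd, fun U _ O T v => ?_⟩
    simp only [Val.toList_ofList, List.mem_reverse, List.mem_flatMap, Val.toList_ofTraining,
      List.mem_map, ext_none, Near]
    constructor
    · rintro ⟨_, ⟨p, hp, rfl⟩, hv⟩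
      rw [Val.hd, Val.toList_ofTuple] at hv
      obtain ⟨a, rfl⟩ := (List.mem_ofFn' _ _).1 hv
      exact ⟨p, hp, a, _, rfl, rfl⟩
    · rintro ⟨p, hp, a, y, rfl, rfl⟩
      exact ⟨_, ⟨p, hp, rfl⟩, by
        rw [Val.hd, Val.toList_ofTuple]
        exact (List.mem_ofFn' _ _).2 ⟨a, rfl⟩⟩
  | succ R ih =>
    obtain ⟨f, hf, h⟩ := ih
    -- The ball grows at its outer end, so paths are split at their last step by `near_succ'`.
    refine ⟨_, hf.flatMap ((var (L := L) none).cons (var none).nbrs), fun U _ O T v => ?_⟩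
    simp only [Val.toList_ofList, List.mem_reverse, List.mem_flatMap, ext_none, h, near_succ',
      Val.toList]
    constructor
    · rintro ⟨_, ⟨p, hp, a, z, hz, rfl⟩, hv⟩
      simp only [nbrAnswer, Val.toList_ofList, List.mem_cons, List.mem_map, O.mem_list] at hv
      rcases hv with rfl | ⟨y, hy, rfl⟩
      · exact ⟨p, hp, a, z, ⟨z, hz, Close.refl z⟩, rfl⟩
      · exact ⟨p, hp, a, y, ⟨z, hz, Or.inr hy⟩, rfl⟩
    · rintro ⟨p, hp, a, y, ⟨z, hz, hzy⟩, rfl⟩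
      refine ⟨_, ⟨p, hp, a, z, hz, rfl⟩, ?_⟩
      simp only [nbrAnswer, Val.toList_ofList, List.mem_cons, List.mem_map, O.mem_list]
      rcases hzy with rfl | hzy
      · exact Or.inl rfl
      · exact Or.inr ⟨y, hzy, rfl⟩

/-- The parameter tuples in the `R`-neighbourhood of the training examples. -/
theorem exists_parameters (L : FirstOrder.Language.{0, 0}) (k R l : ℕ) :
    ∃ f : Family L Unit, PolyTime f ∧ ∀ (U : Type) [L.Structure U] (O : NbrOracle L U)
      (T : List ((Fin k → U) × Bool)) (v : Val U), v ∈ (f U O fun _ => .ofTraining T).toList ↔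
        ∃ w : Fin l → U, (∀ j, ∃ p ∈ T, ∃ a, Near L R (p.1 a) (w j)) ∧ v = .ofTuple w := by
  induction l with
  | zero =>
    refine ⟨_, nil.cons nil, fun U _ O T v => ?_⟩
    simp [Val.toList, Val.ofTuple, Val.ofList]
  | succ l ih =>
    obtain ⟨b, hb, hball⟩ := exists_ball L k R
    obtain ⟨f, hf, h⟩ := ih
    refine ⟨_, hb.flatMap ((hf.comp_map (some : Unit → Option Unit)).flatMap
      (((var (L := L) (some none)).cons (var none)).cons nil)), fun U _ O T v => ?_⟩
    simp only [Val.toList_ofList, List.mem_reverse, List.mem_flatMap, ext_none, ext_some, h, hball,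
      Val.toList, List.mem_singleton]
    constructor
    · rintro ⟨_, ⟨p, hp, a, y, hy, rfl⟩, _, ⟨w, hw, rfl⟩, rfl⟩
      refine ⟨Fin.cons y w, fun j => ?_, (Val.ofTuple_cons y w).symm⟩
      refine Fin.cases ?_ (fun j => ?_) j
      · exact ⟨p, hp, a, by simpa using hy⟩
      · simpa using hw j
    · rintro ⟨w, hw, rfl⟩
      obtain ⟨p, hp, a, hy⟩ := hw 0
      refine ⟨_, ⟨p, hp, a, w 0, hy, rfl⟩, _, ⟨fun j => w j.succ, fun j => hw j.succ, rfl⟩, ?_⟩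
      rw [← Val.ofTuple_cons]
      exact congrArg _ (Fin.cons_self_tail w).symm

open Classical in
theorem exists_sat_tuple {k l : ℕ} (χ : GFormula L (k + l)) {f g : Family L α} (hf : PolyTime f)
    (hg : PolyTime g) : ∃ h : Family L α, PolyTime h ∧ ∀ (U : Type) [L.Structure U]
      (O : NbrOracle L U) σ (u : Fin k → U) (v : Fin l → U), f U O σ = .ofTuple u →
        g U O σ = .ofTuple v →
        h U O σ = .ofBool (decide (χ.Sat (Sum.elim u v ∘ finSumFinEquiv.symm))) := by
  obtain ⟨s, hs, h⟩ := exists_sat χ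
  let c : Fin k ⊕ Fin l → Family L α := fun a U _ O σ =>
    a.elim (fun i : Fin k => (Val.tl^[(i : ℕ)] (f U O σ)).hd) (fun j : Fin l => (Val.tl^[(j : ℕ)] (g U O σ)).hd)
  have hc : ∀ a, PolyTime (c a) := by
    rintro (i | j)
    · exact hf.get i
    · exact hg.get j
  refine ⟨_, hs.subst fun i => hc (finSumFinEquiv.symm i), fun U _ O σ u v hu hv => ?_⟩
  rw [← h U O]
  congr 1
  funext i
  simp only [Function.comp]
  generalize finSumFinEquiv.symm i = a
  rcases a with a | a
  · simp only [c, hu, Sum.elim_inl, Val.hd_iterate_tl_ofTuple]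
  · simp only [c, hv, Sum.elim_inr, Val.hd_iterate_tl_ofTuple]

theorem _root_.List.length_flatMap_map_eq_countP {X Y Z : Type*} (T : List X) (e : X → Y)
    (g : Y → List Z) (b : X → Bool) (h : ∀ p, (g (e p)).length = if b p then 1 else 0) :
    ((T.map e).flatMap g).length = T.countP b := by
  induction T with
  | nil => rfl
  | cons p T ih =>
    rw [List.map_cons, List.flatMap_cons, List.length_append, ih, h, List.countP_cons, add_comm]

open Classical in
/-- The list of the training examples on which a hypothesis is wrong. -/
theorem exists_errors {k l : ℕ} (χ : GFormula L (k + l)) : ∃ f : Family L (Option Unit),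
    PolyTime f ∧ ∀ (U : Type) [L.Structure U] (O : NbrOracle L U) (T : List ((Fin k → U) × Bool))
      (v : Fin l → U), (f U O (ext (fun _ => .ofTraining T) (.ofTuple v))).toList.length =
        T.countP fun p => decide (χ.Sat (Sum.elim p.1 v ∘ finSumFinEquiv.symm)) != p.2 := by
  obtain ⟨s, hs, h⟩ := exists_sat_tuple χ (var (L := L) (none : Option (Option Unit))).hd
    (var (L := L) (some none))
  -- The number of errors is kept in unary, as a list of marks, so no arithmetic is needed.
  refine ⟨_, (var (some ())).flatMap (ite (eq hs (var (L := L) none).tl) nil (true_.cons nil)),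
    fun U _ O T v => ?_⟩
  rw [Val.toList_ofList, List.length_reverse]
  refine (congrArg (fun l => (List.flatMap _ l).length) (Val.toList_ofTraining T)).trans
    (List.length_flatMap_map_eq_countP _ _ _ _ fun p => ?_)
  rw [h U O _ p.1 v rfl rfl]
  have e : ∀ σ : Option Unit → Val U,
      (ext σ (Val.cons (Val.ofTuple p.1) (Val.ofBool p.2)) none).tl = Val.ofBool p.2 := fun _ => rfl
  simp only [e, Val.ofBool_eq_nil, Val.ofBool_injective.eq_iff]
  generalize decide (χ.Sat (Sum.elim p.1 v ∘ finSumFinEquiv.symm)) = b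
  cases b <;> cases p.2 <;> simp [Val.toList, Val.ofBool]

open Classical in
/-- A hypothesis of minimal training error among all given formulas with parameters in the
`R`-neighbourhood of the training examples can be found in polynomial time. -/
theorem exists_learner [L.IsRelational] [Encodable (Σ n, L.Relations n)] {k l K : ℕ} (R : ℕ)
    (χ : Fin K → GFormula L (k + l)) (φ : Fin K → L.Formula (Fin k ⊕ Fin l)) :
    ∃ f : Family L Unit, PolyTime f ∧ ∀ (U : Type) [L.Structure U] (O : NbrOracle L U)
      (T : List ((Fin k → U) × Bool)),
      (∃ (_ : Fin K) (w : Fin l → U), ∀ j, ∃ p ∈ T, ∃ a, Near L R (p.1 a) (w j)) →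
      ∃ (i : Fin K) (v : Fin l → U),
        (f U O fun _ => .ofTraining T) = .cons (.ofFormula (φ i)) (.ofTuple v) ∧
        ∀ (i' : Fin K) (w : Fin l → U), (∀ j, ∃ p ∈ T, ∃ a, Near L R (p.1 a) (w j)) →
          (T.countP fun p => decide ((χ i).Sat (Sum.elim p.1 v ∘ finSumFinEquiv.symm)) != p.2) ≤
          T.countP fun p => decide ((χ i').Sat (Sum.elim p.1 w ∘ finSumFinEquiv.symm)) != p.2 := by
  obtain ⟨V, hV, hpar⟩ := exists_parameters L k R l
  choose err herr hlen using fun i => exists_errors (χ i)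
  -- The error list stands at the head, where `exists_argmin` compares; the output is the tail of
  -- the winner.
  let cand : (U : Type) → [L.Structure U] → NbrOracle L U → List ((Fin k → U) × Bool) → Fin K →
      (Fin l → U) → Val U := fun U _ O T i w => .cons
        (err i U O (ext (fun _ => .ofTraining T) (.ofTuple w)))
        (.cons (.ofFormula (φ i)) (.ofTuple w))
  have list : ∀ I : List (Fin K), ∃ C : Family L Unit, PolyTime C ∧ ∀ (U : Type) [L.Structure U]
      (O : NbrOracle L U) (T : List ((Fin k → U) × Bool)) (c : Val U),
      c ∈ (C U O fun _ => .ofTraining T).toList ↔ ∃ i ∈ I, ∃ w : Fin l → U,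
        (∀ j, ∃ p ∈ T, ∃ a, Near L R (p.1 a) (w j)) ∧ c = cand U O T i w := by
    intro I
    induction I with
    | nil => exact ⟨_, nil, fun U _ O T c => by simp [Val.toList]⟩
    | cons i I ih =>
      obtain ⟨C, hC, h⟩ := ih
      obtain ⟨D, hD, h'⟩ := (hV.flatMap
        (((herr i).cons ((ofFormula (φ i)).cons (var none))).cons nil)).append hC
      refine ⟨D, hD, fun U _ O T c => ?_⟩
      rw [h', h, Val.toList_ofList]
      simp only [List.mem_reverse, List.mem_flatMap, hpar, Val.toList, List.mem_cons,
        exists_eq_or_imp, List.not_mem_nil, or_false]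
      refine or_congr ⟨?_, ?_⟩ Iff.rfl
      · rintro ⟨_, ⟨w, hw, rfl⟩, rfl⟩
        exact ⟨w, hw, rfl⟩
      · rintro ⟨w, hw, rfl⟩
        exact ⟨_, ⟨w, hw, rfl⟩, rfl⟩
  obtain ⟨C, hC, hmem⟩ := list Finset.univ.toList
  obtain ⟨b, hb, hmin⟩ := exists_argmin hC
  refine ⟨_, hb.tl, fun U _ O T hne => ?_⟩
  have mem : ∀ i (w : Fin l → U), (∀ j, ∃ p ∈ T, ∃ a, Near L R (p.1 a) (w j)) →
      cand U O T i w ∈ (C U O fun _ => .ofTraining T).toList := fun i w hw =>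
    (hmem U O T _).2 ⟨i, by simp, w, hw, rfl⟩
  obtain ⟨i₀, w₀, hw₀⟩ := hne
  obtain ⟨h1, h2⟩ := hmin U O _ (List.ne_nil_of_mem (mem i₀ w₀ hw₀))
  obtain ⟨i, -, v, -, hv⟩ := (hmem U O T _).1 h1
  refine ⟨i, v, by rw [hv]; rfl, fun i' w hw => ?_⟩
  have := h2 _ (mem i' w hw)
  rw [hv] at this
  simpa only [cand, Val.hd, hlen] using this

open Classical in
/-- The given formulas can be evaluated in polynomial time. -/
theorem exists_evaluator [L.IsRelational] [Encodable (Σ n, L.Relations n)] {k l K : ℕ}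
    (χ : Fin K → GFormula L (k + l)) (φ : Fin K → L.Formula (Fin k ⊕ Fin l))
    (h : ∀ (i : Fin K) (U : Type) [L.Structure U] (u : Fin k ⊕ Fin l → U),
      (φ i).Realize u ↔ (χ i).Sat (u ∘ finSumFinEquiv.symm)) :
    ∃ f : Family L Unit, PolyTime f ∧ ∀ (U : Type) [L.Structure U] (O : NbrOracle L U) (i : Fin K)
      (v : Fin l → U) (u : Fin k → U),
      (f U O fun _ => .cons (.ofFormula (φ i)) (.cons (.ofTuple v) (.ofTuple u))) =
        .ofBool (concept (φ i) v u) := by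
  have list : ∀ I : List (Fin K), ∃ f : Family L Unit, PolyTime f ∧ ∀ (U : Type) [L.Structure U]
      (O : NbrOracle L U), ∀ i ∈ I, ∀ (v : Fin l → U) (u : Fin k → U),
        (f U O fun _ => .cons (.ofFormula (φ i)) (.cons (.ofTuple v) (.ofTuple u))) =
          .ofBool (concept (φ i) v u) := by
    intro I
    induction I with
    | nil => exact ⟨_, nil, fun U _ O i hi => by simp at hi⟩
    | cons j I ih =>
      obtain ⟨f, hf, hI⟩ := ih
      obtain ⟨s, hs, hsat⟩ := exists_sat_tuple (χ j) (var (L := L) ()).tl.tl (var (L := L) ()).tl.hd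
      -- Only `K` codes can occur, so the code is compared with each of them and the matching
      -- guarded test is run; no syntax is interpreted.
      refine ⟨_, ite (eq (var ()).hd (ofFormula (φ j))) hs hf, fun U _ O i hi v u => ?_⟩
      by_cases hc : (Val.ofFormula (φ i) : Val U) = .ofFormula (φ j)
      · refine (if_neg fun hn => of_decide_eq_false (Val.ofBool_eq_nil.1 hn) hc).trans ?_
        rw [hsat U O _ u v rfl rfl, Val.ofFormula_injective hc]
        simp only [concept, h]
      · refine (if_pos (Val.ofBool_eq_nil.2 (decide_eq_false hc))).trans ?_
        rcases List.mem_cons.1 hi with rfl | hi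
        · exact absurd rfl hc
        · exact hI U O i hi v u
  obtain ⟨f, hf, hI⟩ := list Finset.univ.toList
  exact ⟨f, hf, fun U _ O i v u => hI U O i (by simp) v u⟩

/-! ### Explicit time bounds. -/

theorem bounded_of_maxDegree_le {U : Type} [L.Structure U] [Fintype U] (O : NbrOracle L U) {X : ℕ}
    (hw : Nat.log 2 (Fintype.card U) + 1 ≤ X) (hd : maxDegree L U ≤ X) :
    Bounded O (Nat.log 2 (Fintype.card U) + 1) X := by
  classical
  refine ⟨Nat.le_add_left _ _, hw, fun u => ?_⟩
  refine le_trans ?_ (((gaifmanGraph L U).degree_le_maxDegree u).trans hd)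
  rw [← List.toFinset_card_of_nodup (O.nodup u), ← SimpleGraph.card_neighborFinset_eq_degree]
  refine Finset.card_le_card fun v hv => ?_
  simpa [O.mem_list] using hv

theorem exists_computesIn {f : Family L Unit} (hf : PolyTime f) :
    ∃ (p : Prog L) (τ : Polynomial ℕ), ∀ (U : Type) [L.Structure U] [Fintype U]
      (O : NbrOracle L U) (a : Val U) (X : ℕ), Nat.log 2 (Fintype.card U) + 1 ≤ X →
      maxDegree L U ≤ X → a.size (Nat.log 2 (Fintype.card U) + 1) ≤ X →
        ComputesIn O p a (f U O fun _ => a) (τ.eval X) := by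
  obtain ⟨p, τ, hp⟩ := hf (fun _ => 0) 1 (fun _ => one_pos)
  refine ⟨.seq p (.assign 0 (.var 1)), 2 * τ + 1, fun U _ _ O a X hw hd ha => ?_⟩
  obtain ⟨s', t, e, hv, -, ht, hsz⟩ := hp U O _ X (bounded_of_maxDegree_le O hw hd)
    (Function.update (fun _ => Val.nil) 0 a) (fun _ => by simpa using ha)
  simp only [Function.update_self] at hv hsz
  refine ⟨_, _, Exec.seq e (Exec.assign _ _ _), by simp [Expr.eval, hv], ?_⟩
  simp [Expr.cost, hv]
  omega

/-- Writing down a fixed formula is a `PolyTime` computation without arguments, and `PolyTime`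
bounds the size of its output. -/
theorem exists_size_ofFormula_le [L.IsRelational] [Encodable (Σ n, L.Relations n)] {k l n : ℕ}
    (φ : L.BoundedFormula (Fin k ⊕ Fin l) n) : ∃ τ : Polynomial ℕ, ∀ (U : Type) [L.Structure U]
      (O : NbrOracle L U) (w X : ℕ), Bounded O w X →
        (Val.ofFormula φ : Val U).size w ≤ τ.eval X := by
  obtain ⟨p, τ, hp⟩ := ofFormula (α := Empty) φ Empty.elim 0 fun a => a.elim
  refine ⟨τ, fun U _ O w X hX => ?_⟩
  obtain ⟨_, _, _, _, _, _, h⟩ := hp U O w X hX (fun _ => .nil) fun a => a.elim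
  exact h

end PolyTime

theorem exists_eval_le (p : Polynomial ℕ) : ∃ c, ∀ n, 1 ≤ n → p.eval n ≤ c * n ^ c := by
  -- For `n ≥ 1`, `p.eval n` is at most `p.eval 1 * n ^ p.natDegree`; the sum serves both as factor
  -- and as exponent.
  refine ⟨p.eval 1 + p.natDegree, fun n hn => ?_⟩
  rw [Polynomial.eval_eq_sum_range, Polynomial.eval_eq_sum_range]
  calc ∑ i ∈ Finset.range (p.natDegree + 1), p.coeff i * n ^ i
      ≤ ∑ i ∈ Finset.range (p.natDegree + 1), p.coeff i * 1 ^ i *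
          n ^ ((∑ i ∈ Finset.range (p.natDegree + 1), p.coeff i * 1 ^ i) + p.natDegree) := by
        refine Finset.sum_le_sum fun i hi => ?_
        rw [one_pow, mul_one]
        refine Nat.mul_le_mul_left _ (Nat.pow_le_pow_right hn ?_)
        have := Finset.mem_range.1 hi
        omega
    _ ≤ _ := by
        rw [← Finset.sum_mul]
        exact Nat.mul_le_mul_right _ (Nat.le_add_right _ _)

end LocalLearning

/-! ### The learning theorem. -/

open LocalLearning in
theorem theorem4 (L : FirstOrder.Language.{0, 0}) [L.IsRelational] [Finite (Σ n, L.Relations n)]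
    [Encodable (Σ n, L.Relations n)] (k l q : ℕ) (hk : 0 < k ∨ l = 0) :
    ∃ (qs rs : ℕ) (M E : Prog L) (c : ℕ),
      ∀ (U : Type) [L.Structure U] [Fintype U] (O : NbrOracle L U)
        (T : List ((Fin k → U) × Bool)), T ≠ [] →
        ∃ (φ : L.Formula (Fin k ⊕ Fin l)) (v : Fin l → U),
          -- `M` returns the hypothesis given by `φ` and `v`, within the time bound
          ComputesIn O M (Val.ofTraining T) (Val.cons (Val.ofFormula φ) (Val.ofTuple v))
            (c * (Nat.log 2 (Fintype.card U) + maxDegree L U + T.length + 1) ^ c) ∧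
          IsLocal rs φ ∧ qrank φ = qs ∧
          -- its training error is at most that of every concept of quantifier rank `≤ q`
          (∀ ε : ℝ,
            (∃ (ψ : L.Formula (Fin k ⊕ Fin l)) (w : Fin l → U),
              qrank ψ ≤ q ∧ trainErr T (concept ψ w) ≤ ε) →
            trainErr T (concept φ v) ≤ ε) ∧
          -- `E` evaluates the returned hypothesis on every instance, within the time bound
          (∀ (O' : NbrOracle L U) (u : Fin k → U),
            ComputesIn O' E
              (Val.cons (Val.ofFormula φ) (Val.cons (Val.ofTuple v) (Val.ofTuple u)))
              (Val.ofBool (concept φ v u))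
              (c * (Nat.log 2 (Fintype.card U) + maxDegree L U + 1) ^ c)) := by
  classical
  obtain ⟨qs, rs, R, K, χ, φ, hφ, hopt⟩ := GFormula.exists_hypotheses L k l q
  obtain ⟨f, hf, hlearn⟩ := PolyTime.exists_learner R χ φ
  obtain ⟨g, hg, heval⟩ := PolyTime.exists_evaluator χ φ fun i => (hφ i).2.2
  obtain ⟨M, τ, hM⟩ := hf.exists_computesIn
  obtain ⟨E, τ', hE⟩ := hg.exists_computesIn
  choose σ hσ using fun i => PolyTime.exists_size_ofFormula_le (φ i)
  -- At `Y`, the sum of the size parameters and `1`, `P` bounds the element size, the degree and the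
  -- encoded training sequence.
  let P : Polynomial ℕ := Polynomial.X +
    (1 + Polynomial.X * (1 + (1 + (1 + (k : Polynomial ℕ) * (1 + Polynomial.X)) + 3)))
  -- The evaluator's input is bounded independently of `T`: the sum over all `σ i` covers whichever
  -- formula is returned.
  let P' : Polynomial ℕ := Polynomial.X + (1 + ∑ i, σ i +
    (1 + (1 + (l : Polynomial ℕ) * (1 + Polynomial.X)) +
      (1 + (k : Polynomial ℕ) * (1 + Polynomial.X))))
  obtain ⟨c, hc⟩ := exists_eval_le (τ.comp P)
  obtain ⟨c', hc'⟩ := exists_eval_le (τ'.comp P')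
  refine ⟨qs, rs, M, E, c + c', fun U _ _ O T hT => ?_⟩
  let S : Set (Fin k → U) := {u | ∃ p ∈ T, p.1 = u}
  -- Placeholders for far parameters: an entry of some training instance, which needs `0 < k`, or
  -- nothing when `l = 0`.
  obtain ⟨t, ht⟩ : ∃ t : Fin l → U, ∀ j, ∃ u ∈ S, ∃ a, u a = t j := by
    rcases hk with hk | rfl
    · obtain ⟨p, hp⟩ := List.exists_mem_of_ne_nil T hT
      exact ⟨fun _ => p.1 ⟨0, hk⟩, fun _ => ⟨p.1, ⟨p, hp, rfl⟩, ⟨0, hk⟩, rfl⟩⟩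
    · exact ⟨Fin.elim0, fun j => j.elim0⟩
  have near : ∀ v : Fin l → U, (∀ j, ∃ u ∈ S, ∃ a, Near L R (u a) (v j)) →
      ∀ j, ∃ p ∈ T, ∃ a, Near L R (p.1 a) (v j) := by
    intro v hv j
    obtain ⟨_, ⟨p, hp, rfl⟩, h⟩ := hv j
    exact ⟨p, hp, h⟩
  have opt : ∀ (ψ : L.Formula (Fin k ⊕ Fin l)) (w : Fin l → U), qrank ψ ≤ q →
      ∃ (i : Fin K) (v : Fin l → U), (∀ j, ∃ p ∈ T, ∃ a, Near L R (p.1 a) (v j)) ∧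
        ∀ p ∈ T, concept (φ i) v p.1 = concept ψ w p.1 := by
    intro ψ w hψ
    obtain ⟨i, v, hv, h⟩ := hopt U S t ht ψ w hψ
    refine ⟨i, v, near v hv, fun p hp => ?_⟩
    simp only [concept, h p.1 ⟨p, hp, rfl⟩]
  obtain ⟨i, v, hout, hmin⟩ := hlearn U O T (by
    -- Applying `opt` to the trivial competitor `⊥` shows that there is a candidate at all.
    obtain ⟨i, v, hv, -⟩ := opt ⊥ t (Nat.zero_le q)
    exact ⟨i, v, hv⟩)
  have herr : ∀ i (v : Fin l → U), (T.countP fun p => concept (φ i) v p.1 != p.2) = T.countP fun p =>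
      decide ((χ i).Sat (Sum.elim p.1 v ∘ finSumFinEquiv.symm)) != p.2 := by
    intro i v
    simp only [concept, (hφ i).2.2]
  refine ⟨φ i, v, ?_, (hφ i).1, (hφ i).2.1, ?_, fun O' u => ?_⟩
  · rw [← hout]
    have hY : 1 ≤ Nat.log 2 (Fintype.card U) + maxDegree L U + T.length + 1 := Nat.le_add_left _ _
    set Y := Nat.log 2 (Fintype.card U) + maxDegree L U + T.length + 1 with hYdef
    have hPY : P.eval Y = Y + (1 + Y * (1 + (1 + (1 + k * (1 + Y)) + 3))) := by simp [P]
    obtain ⟨s, t, e, h0, ht⟩ := hM U O (Val.ofTraining T) (P.eval Y) (by omega) (by omega) (by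
      refine (Val.size_ofTraining_le T).trans (le_trans ?_ (hPY ▸ Nat.le_add_left _ Y))
      gcongr <;> omega)
    refine ⟨s, t, e, h0, ht.trans ?_⟩
    rw [← Polynomial.eval_comp]
    refine (hc Y hY).trans ?_
    gcongr <;> omega
  · rintro ε ⟨ψ, w, hψ, hε⟩
    obtain ⟨i', v', hv', hcon⟩ := opt ψ w hψ
    refine le_trans ?_ hε
    have e : (T.countP fun p => concept ψ w p.1 != p.2) =
        T.countP fun p => concept (φ i') v' p.1 != p.2 :=
      List.countP_congr fun p hp => by rw [hcon p hp]
    unfold trainErr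
    rw [e, herr, herr]
    gcongr
    exact hmin i' v' hv'
  · rw [← heval U O' i v u]
    have hY : 1 ≤ Nat.log 2 (Fintype.card U) + maxDegree L U + 1 := Nat.le_add_left _ _
    set Y := Nat.log 2 (Fintype.card U) + maxDegree L U + 1 with hYdef
    have hPY : P'.eval Y = Y + (1 + ∑ i, (σ i).eval Y + (1 + (1 + l * (1 + Y)) +
        (1 + k * (1 + Y)))) := by
      simp [P', Polynomial.eval_finsetSum]
    obtain ⟨s, t, e, h0, ht⟩ := hE U O'
      (.cons (.ofFormula (φ i)) (.cons (.ofTuple v) (.ofTuple u))) (P'.eval Y)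
      (by omega) (by omega) (by
        refine le_trans ?_ (hPY ▸ Nat.le_add_left _ Y)
        refine Nat.add_le_add (Nat.add_le_add_left ?_ 1)
          (Nat.add_le_add (Nat.add_le_add_left ?_ 1) ?_)
        · exact (hσ i U O' _ Y (PolyTime.bounded_of_maxDegree_le O' (by omega) (by omega))).trans
            (Finset.single_le_sum (f := fun i => (σ i).eval Y) (fun _ _ => Nat.zero_le _)
              (Finset.mem_univ i))
        · refine (Val.size_ofTuple_le v).trans ?_
          gcongr; omega
        · refine (Val.size_ofTuple_le u).trans ?_
          gcongr; omega)
    refine ⟨s, t, e, h0, ht.trans ?_⟩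
    rw [← Polynomial.eval_comp]
    refine (hc' Y hY).trans ?_
    gcongr <;> omega
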